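/- **Setting.** Let $f:X\to\{0,1\}$ be a target and $H\subset\{0,1\}^X$ a class of splitting functions satisfying the Weak Learning Assumption with advantage $\gamma>0$: for every probability distribution $P$ on $X$ there is $h\in H$ with $\Pr_{x\sim P}(h(x)\ne f(x))\le\frac12-\gamma$. A finite sample $S$ of points labelled by $f$ is partitioned arbitrarily among $k\ge1$ entities, $S=\bigcup_{i}S^i$. For a sample $S'$ let $q(S')$ be its fraction of points with label $1$, let $G(q)=-q\lg q-(1-q)\lg(1-q)$, and for $h\in H$ put $$J(S',h)=G(q(S'))-\tfrac{|S'_0|}{|S'|}G(q(S'_0))-\tfrac{|S'_1|}{|S'|}G(q(S'_1)),\qquad S'_j=\{x\in S':h(x)=j\}.$$ **Distributed PrivateSplit.** This is a randomized map $(\ell,\alpha,\delta)\mapsto(\hat h,\hat J)\in H\times\mathbb R$, acting on the parts $(S^1_\ell,\dots,S^k_\ell)$ of the data $S_\ell$ at a leaf $\ell$, such that for $\alpha>0$, $\delta\in(0,1]$: (i) it is $\alpha$-differentially private with respect to the data of each entity (neighbouring data sets differ on at most one point); (ii) for every $\zeta>0$, if $|S_\ell|\ge N(\zeta,\alpha,\delta)$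 then with probability at least $1-\delta$ both $J(S_\ell,\hat h)\ge\max_{h\in H}J(S_\ell,h)-\zeta$ and $|J(S_\ell,\hat h)-\hat J|\le\zeta$. The data requirement $N$ is assumed nonincreasing in $\alpha$. **Distributed DP-TopDown.** The inputs are $M\in\mathbb N$, $\varepsilon,\delta\in(0,1]$, $\alpha>0$ and budgets $\mathcal B(1),\dots,\mathcal B(M)>0$ with $\sum_{d=1}^M\mathcal B(d)\le1$. All random draws below are independent, and every call of PrivateSplit has failure parameter $\delta'=\frac{\delta}{2(2M+1)}$. Start with a single leaf (the root, of depth $0$), call PrivateSplit on it with privacy $\frac\alpha2\mathcal B(1)$, and put it with $\hat h$ in a queue with priority $\hat J$. Repeat $M$ times (doing nothing if the queue is empty): pop a leaf of highest priority and split it by its $\hat h$; for each new leaf $\ell$, of depth $d$, put $\alpha_\ell=\frac\alpha2\mathcal B(d)$, compute the weight estimate $w=\frac1{|S|}\sum_{i=1}^k\bigl(|S^i_\ell|+\mathrm{Lap}(2/\alpha_\ell)\bigr)$, call PrivateSplit on $\ell$ with privacy $\alpha_\ell/2$, and if $w\ge\varepsilon/M$ put $\ell$ with its $\hat h$ in the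 queue with priority $w\hat J$. Finally label each leaf $\ell$ by a $y\in\{0,1\}$ that maximizes $\sum_{i=1}^k\bigl(|\{x\in S^i_\ell:f(x)=y\}|+\mathrm{Lap}(4/\alpha)\bigr)$. **Statement.** There are universal constants $C_1,C_2,c_3>0$ such that, in the above setting with $b=\min_{1\le d\le M}\mathcal B(d)$, if $$M\ge(1/\varepsilon)^{C_1\log(1/\varepsilon)/\gamma^2}$$ and $$|S|\ge\max\left(C_2\,\frac{kM}{\gamma^2\varepsilon\alpha b}\,\log\frac{2kM}{\delta}\,\log\frac2\varepsilon,\ \ \frac{2M}{\varepsilon}\,N\!\left(\frac{c_3\,\gamma^2\varepsilon}{M\log(2/\varepsilon)},\ \frac{\alpha b}{4},\ \frac{\delta}{2(2M+1)}\right)\right),$$ then with probability at least $1-\delta$ over the randomness of the algorithm, the tree output by distributed DP-TopDown has training error on $S$ at most $\varepsilon$. In other words, $(1/\varepsilon)^{O(\log(1/\varepsilon)/\gamma^2)}$ splits suffice, with sample size $|S|\ge\max\bigl(\widetilde O(\frac{kM}{\gamma^2\varepsilon\alpha b}),\frac{2M}{\varepsilon}N(\widetilde O(\frac{\gamma^2\varepsilon}{M}),\frac{\alpha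 b}{4},O(\frac{\delta}{M}))\bigr)$. -/

import Mathlib

open MeasureTheory

noncomputable section

namespace DPTopDown

/-! ### Datasets, splitting criterion, weak learning -/

/-- A dataset distributed over `k` entities: entity `i` holds the finite sample `D i`.
The target `f : X → Bool` is fixed throughout, so the labelled example `(x, f x)` is recorded
by the point `x`; repeated points are kept. -/
abbrev Dataset (X : Type*) (k : ℕ) := Fin k → Multiset X

/-- The union (with multiplicity) of the data of all entities. -/
def Dataset.total {X : Type*} {k : ℕ} (D : Dataset X k) : Multiset X := ∑ i, D i

/-- The number of data points held by all entities together. -/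
def Dataset.size {X : Type*} {k : ℕ} (D : Dataset X k) : ℕ := D.total.card

/-- The part of the data lying in a region of `X` (each entity restricts its own data). -/
def Dataset.restrict {X : Type*} {k : ℕ} (D : Dataset X k) (R : X → Prop) [DecidablePred R] :
    Dataset X k := fun i => (D i).filter R

/-- Two samples are neighbouring if they differ on at most one point. -/
def Neighboring {X : Type*} (S S' : Multiset X) : Prop :=
  ∃ T : Multiset X, T ≤ S ∧ T ≤ S' ∧ S.card ≤ T.card + 1 ∧ S'.card ≤ T.card + 1

/-- The binary entropy `-q lg q - (1-q) lg (1-q)`, logarithms to base two, so that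
its value at `1/2` is one. -/
def entropy (q : ℝ) : ℝ := Real.binEntropy q / Real.log 2

/-- The fraction `q` of a sample that has label one. -/
def posFrac {X : Type*} (f : X → Bool) (S : Multiset X) : ℝ :=
  (S.countP (fun x => f x = true) : ℝ) / (S.card : ℝ)

/-- The gain `J(S, h)` of splitting the sample `S` by `h`:
`G(q) - |S₀|/|S| G(q₀) - |S₁|/|S| G(q₁)`, with `S₀`, `S₁` the parts where `h = 0`, `h = 1`. -/
def gain {X : Type*} (f : X → Bool) (S : Multiset X) (h : X → Bool) : ℝ :=
  let S₀ := S.filter (fun x => h x = false)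
  let S₁ := S.filter (fun x => h x = true)
  entropy (posFrac f S)
    - (S₀.card : ℝ) / (S.card : ℝ) * entropy (posFrac f S₀)
    - (S₁.card : ℝ) / (S.card : ℝ) * entropy (posFrac f S₁)

/-- The Weak Learning Assumption with advantage `γ`. -/
def WeakLearning {X : Type*} [MeasurableSpace X] (f : X → Bool) (H : Set (X → Bool))
    (γ : ℝ) : Prop :=
  ∀ P : Measure X, IsProbabilityMeasure P →
    ∃ h ∈ H, P.real {x | h x ≠ f x} ≤ 1 / 2 - γ

/-! ### Distributed `PrivateSplit` -/

/-- A randomized split selector. Its arguments are the data `(S¹_ℓ, …, Sᵏ_ℓ)` at a leaf, a privacy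
parameter, a failure probability and a random seed; it returns a pair `(ĥ, Ĵ)` in `H × ℝ`.
The class `H` carries the sigma-algebra generated by the evaluations `h ↦ h x`. -/
abbrev SplitMechanism {X : Type*} (H : Set (X → Bool)) (k : ℕ) (Ω : Type*) :=
  Dataset X k → ℝ → ℝ → Ω → H × ℝ

/-- `PS`, run with a seed drawn from `P`, is a distributed implementation of `PrivateSplit` with
data requirement `N ζ α δ`. -/
structure IsPrivateSplit {X : Type*} (f : X → Bool) (H : Set (X → Bool)) {k : ℕ} {Ω : Type*}
    [MeasurableSpace Ω] (P : Measure Ω) (PS : SplitMechanism H k Ω) (N : ℝ → ℝ → ℝ → ℝ) :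
    Prop where
  /-- The outcome is a random variable. -/
  measurable : ∀ D α δ, Measurable (PS D α δ)
  /-- `α`-differential privacy for the data of each entity. -/
  dp : ∀ α δ : ℝ, 0 < α → 0 < δ → δ ≤ 1 → ∀ (i : Fin k) (D D' : Dataset X k),
    Neighboring (D i) (D' i) → (∀ j, j ≠ i → D j = D' j) →
    ∀ O : Set (H × ℝ), MeasurableSet O →
      P {ω | PS D α δ ω ∈ O} ≤ ENNReal.ofReal (Real.exp α) * P {ω | PS D' α δ ω ∈ O}
  /-- With `N ζ α δ` data points, with probability at least `1 - δ` the split returned is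
  `ζ`-optimal and its gain is known up to `ζ`. -/
  utility : ∀ ζ α δ : ℝ, 0 < ζ → 0 < α → 0 < δ → δ ≤ 1 → ∀ D : Dataset X k,
    N ζ α δ ≤ (D.size : ℝ) →
      ENNReal.ofReal (1 - δ) ≤
        P {ω | (∀ h : H, gain f D.total h - ζ ≤ gain f D.total (PS D α δ ω).1) ∧
          |gain f D.total (PS D α δ ω).1 - (PS D α δ ω).2| ≤ ζ}

/-! ### Decision trees -/

/-- Binary trees whose internal nodes carry splitting functions from `H` and whose leaves carry
elements of `L` (node names while the tree is being built, class labels at the end). -/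
inductive DTree {X : Type*} (H : Set (X → Bool)) (L : Type) where
  | leaf (a : L) : DTree H L
  | node (h : H) (left right : DTree H L) : DTree H L

/-- The content of the leaf that `x` is routed to: left if `h x = 0`, right if `h x = 1`. -/
def DTree.eval {X : Type*} {H : Set (X → Bool)} {L : Type} : DTree H L → X → L
  | .leaf a, _ => a
  | .node h l r, x => if h.1 x = true then r.eval x else l.eval x

/-- Change the contents of the leaves. -/
def DTree.map {X : Type*} {H : Set (X → Bool)} {L L' : Type} (g : L → L') :
    DTree H L → DTree H L'
  | .leaf a => .leaf (g a)
  | .node h l r => .node h (l.map g) (r.map g)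

/-- `T(ℓ, h)`: the leaf named `ℓ` becomes an internal node that splits by `h`, with
children leaves `ℓ₀` and `ℓ₁`. -/
def DTree.split {X : Type*} {H : Set (X → Bool)} {L : Type} [DecidableEq L]
    (ℓ : L) (h : H) (ℓ₀ ℓ₁ : L) : DTree H L → DTree H L
  | .leaf a => if a = ℓ then .node h (.leaf ℓ₀) (.leaf ℓ₁) else .leaf a
  | .node g l r => .node g (l.split ℓ h ℓ₀ ℓ₁) (r.split ℓ h ℓ₀ ℓ₁)

/-- The training error: the fraction of the data that the tree misclassifies. -/
def trainError {X : Type*} {k : ℕ} {H : Set (X → Bool)} (f : X → Bool) (S : Dataset X k)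
    (T : DTree H Bool) : ℝ :=
  (S.total.countP (fun x => T.eval x ≠ f x) : ℝ) / (S.size : ℝ)

/-! ### The algorithm -/

/-- The numerical inputs of the algorithm: maximal number `M` of internal nodes, error `ε`,
privacy `α`, failure probability `δ`, and the budget function `B`. -/
structure Params where
  M : ℕ
  ε : ℝ
  α : ℝ
  δ : ℝ
  B : ℕ → ℝ

/-- Names of the nodes of the tree: `0` is the root, and the `t`-th split
(`t = 0, …, M-1`) creates the nodes `2t+1` and `2t+2`. -/
abbrev Node (p : Params) := Fin (2 * p.M + 1)

/-- The randomness used at one node: a seed for the call of `PrivateSplit`; for each entity a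
Laplace variable for the weight estimate; for each label and each entity a Laplace variable
for the labelling (used only if the node remains a leaf). -/
abbrev Seed (k : ℕ) (Ω : Type*) := Ω × (Fin k → ℝ) × (Bool → Fin k → ℝ)

/-- The standard Laplace distribution `Lap(1)`, with density `exp (-|x|) / 2`.
If `Z` has this law then `s * Z` has law `Lap(s)` for every `s > 0`. -/
def laplace : Measure ℝ :=
  (volume : Measure ℝ).withDensity (fun x => ENNReal.ofReal (Real.exp (-|x|) / 2))

/-- The law of all the randomness of one run: everything is independent. -/
def runMeasure (p : Params) (k : ℕ) {Ω : Type*} [MeasurableSpace Ω] (P : Measure Ω) :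
    Measure (Node p → Seed k Ω) :=
  Measure.pi fun _ =>
    P.prod ((Measure.pi fun _ => laplace).prod (Measure.pi fun _ => Measure.pi fun _ => laplace))

/-- An element of the priority queue: a leaf, its depth, the split selected for it and
its priority. -/
structure Entry {X : Type*} (H : Set (X → Bool)) (p : Params) where
  leaf : Node p
  depth : ℕ
  split : H
  priority : ℝ

/-- The current tree and the current queue. -/
structure State {X : Type*} (H : Set (X → Bool)) (p : Params) where
  tree : DTree H (Node p)
  queue : List (Entry H p)

/-- The data `S_ℓ` that reaches the leaf `ℓ` of the tree `T`. -/
def leafData {X : Type*} {H : Set (X → Bool)} {p : Params} {k : ℕ} (S : Dataset X k)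
    (T : DTree H (Node p)) (ℓ : Node p) : Dataset X k :=
  S.restrict (fun x => T.eval x = ℓ)

/-- Distributed weight estimation with budget `a / 2`: entity `i` publishes its number of points
at the leaf plus noise `Lap(2 / a)`; the sum of these numbers is divided by `|S|`. -/
def weightEstimate {X : Type*} {k : ℕ} (S D : Dataset X k) (a : ℝ) (Z : Fin k → ℝ) : ℝ :=
  (∑ i, (((D i).card : ℝ) + 2 / a * Z i)) / (S.size : ℝ)

/-- Distributed estimate of the number of points of label `y` at a leaf: each entity publishes
its own count for `y` by the Laplace mechanism with budget `α / 4` (the budget `α / 2` of the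
labelling is shared by the two labels), that is, with noise `Lap(4 / α)`. -/
def labelCount {X : Type*} {k : ℕ} (f : X → Bool) (D : Dataset X k) (α : ℝ) (y : Bool)
    (Z : Fin k → ℝ) : ℝ :=
  ∑ i, (((D i).countP (fun x => f x = y) : ℝ) + 4 / α * Z i)

section Algorithm

variable {X : Type*} (f : X → Bool) {H : Set (X → Bool)} {k : ℕ} {Ω : Type*} (p : Params)
  (S : Dataset X k) (PS : SplitMechanism H k Ω) (ω : Node p → Seed k Ω)

/-- The failure probability passed to each call of `PrivateSplit`. -/
def callDelta : ℝ := p.δ / (2 * (2 * (p.M : ℝ) + 1))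

/-- Initially the tree is a single leaf, the root, of depth zero; the queue contains the split
selected for it with budget `(α / 2) B(1)`, with priority `Ĵ`. -/
def initState : State H p :=
  let out := PS S (p.α / 2 * p.B 1) (callDelta p) (ω 0).1
  { tree := .leaf 0
    queue := [{ leaf := 0, depth := 0, split := out.1, priority := out.2 }] }

/-- Processing of a new leaf `ℓ` of depth `d` of the tree `T`: estimate its weight, call
`PrivateSplit`, and produce a queue element if the estimated weight is at least `ε / M`. -/
def newEntries (T : DTree H (Node p)) (ℓ : Node p) (d : ℕ) : List (Entry H p) :=
  let a := p.α / 2 * p.B d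
  let D := leafData S T ℓ
  let w := weightEstimate S D a (ω ℓ).2.1
  let out := PS D (a / 2) (callDelta p) (ω ℓ).1
  if p.ε / (p.M : ℝ) ≤ w then
    [{ leaf := ℓ, depth := d, split := out.1, priority := w * out.2 }]
  else []

/-- One iteration of the main loop: pop an element of highest priority, split its leaf, and
process the two children. If the queue is empty nothing is split. -/
def step (t : Fin p.M) (s : State H p) : State H p :=
  match s.queue.argmax Entry.priority with
  | none => s
  | some e =>
    let ℓ₀ : Node p := ⟨2 * t.1 + 1, by have := t.2; omega⟩
    let ℓ₁ : Node p := ⟨2 * t.1 + 2, by have := t.2; omega⟩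
    let T := s.tree.split e.leaf e.split ℓ₀ ℓ₁
    { tree := T
      queue := s.queue.filter (fun e' => e'.leaf ≠ e.leaf)
        ++ newEntries p S PS ω T ℓ₀ (e.depth + 1)
        ++ newEntries p S PS ω T ℓ₁ (e.depth + 1) }

/-- The state after `t` iterations of the main loop. -/
def stateAfter : (t : ℕ) → t ≤ p.M → State H p
  | 0, _ => initState p S PS ω
  | t + 1, ht => step p S PS ω ⟨t, ht⟩ (stateAfter t (Nat.le_of_succ_le ht))

/-- The label given to the leaf `ℓ` of the final tree: the label with the larger noisy count. -/
def leafLabel (T : DTree H (Node p)) (ℓ : Node p) : Bool :=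
  let D := leafData S T ℓ
  decide (labelCount f D p.α false ((ω ℓ).2.2 false)
    ≤ labelCount f D p.α true ((ω ℓ).2.2 true))

/-- The output of distributed DP-TopDown on the data `S` with randomness `ω`. -/
def dpTopDown : DTree H Bool :=
  let T := (stateAfter p S PS ω p.M le_rfl).tree
  T.map (leafLabel f p S ω T)

end Algorithm

end DPTopDown

end

/-! The proof follows a potential: the sum, over the leaves in the queue, of sample size times label
entropy in nats. It starts at no more than |S|. Splitting a leaf with sample A by h lowers it by at
least |A| J(A,h) log 2, and the entropy of children that do not enter the queue disappears as well
(`State.Coherent.potential_step`).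

Weak learning yields a good split. Reweight A so that both labels have mass 1/2. A hypothesis of
error at most 1/2 - γ then takes the value 1 with frequencies differing by at least 2γ on the two
classes. By symmetry of mutual information the gain is also the entropy of h minus its entropy given
the label, and strong concavity of binary entropy bounds this below by 4γ² times the minority count
of A (`WeakLearning.exists_split`). While the potential exceeds ε|S|/4, after t iterations one of at
most t+1 active leaves has minority at least the potential divided by 2(t+1) log(16/ε)
(`exists_minority_ge`). Noisy priorities cost 7η|S| per pop (`State.Coherent.pop_gain`), which is at
most half of the best gain. Each iteration thus multiplies the potential by at most 1 - ρ/(t+1),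
with ρ = γ²/(4 log(2/ε)), until it is below ε|S|/4; after M iterations (M+1)^(-ρ) ≤ ε/4
(`potential_stateAfter_le`, `exp_neg_mul_log_le`).

The training error is at most the sum of the minorities plus labelling noise. Minorities of active
leaves are bounded by the potential. The other leaves number at most M+1 and hold at most about
ε|S|/M points each, of which at most half are in the minority. For ε ≤ 3/4 the parts add up to ε/4 +
3ε/5 + ε/20 < ε; for larger ε the trivial bound 1/2 on the total minority fraction suffices
(`GoodRun.trainError_le`).

All this holds on good runs, where every Laplace variable is small and every relevant call of
`PrivateSplit` succeeds. The data at a new leaf are chosen adaptively but depend only on seeds of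
older nodes, so the guarantee applies conditionally on those (`measure_pi_fresh_le`) and a union
bound over nodes finishes. To condition, the state is replaced by its skeleton, which records only
the assignment of the finitely many data points and the names and depths in the queue; it takes
countably many values. -/

namespace DPTopDown

/-! ### Entropy of a pair of counts -/

/-- The entropy, in nats, of a sample with `x` points of one label and `y` of the other, multiplied
by the size of the sample. -/
noncomputable def countEntropy (x y : ℝ) : ℝ :=
  (x + y) * Real.log (x + y) - x * Real.log x - y * Real.log y

lemma countEntropy_comm (x y : ℝ) : countEntropy x y = countEntropy y x := by
  simp only [countEntropy, add_comm y x]; ring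

lemma countEntropy_zero_left (y : ℝ) : countEntropy 0 y = 0 := by simp [countEntropy]

lemma countEntropy_zero_right (x : ℝ) : countEntropy x 0 = 0 := by simp [countEntropy]

lemma mul_binEntropy_div {x y : ℝ} (hx : 0 ≤ x) (hy : 0 ≤ y) :
    (x + y) * Real.binEntropy (x / (x + y)) = countEntropy x y := by
  rcases hx.eq_or_lt with rfl | hx
  · simp [countEntropy]
  rcases hy.eq_or_lt with rfl | hy
  · simp [countEntropy, hx.ne']
  have h : 1 - x / (x + y) = y / (x + y) := by field_simp; ring
  rw [Real.binEntropy, h, inv_div, inv_div, Real.log_div (by positivity) hx.ne',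
    Real.log_div (by positivity) hy.ne', countEntropy]
  field_simp
  ring

lemma countEntropy_nonneg {x y : ℝ} (hx : 0 ≤ x) (hy : 0 ≤ y) : 0 ≤ countEntropy x y := by
  rw [← mul_binEntropy_div hx hy]
  exact mul_nonneg (by positivity)
    (Real.binEntropy_nonneg (by positivity) (div_le_one_of_le₀ (by linarith) (by positivity)))

lemma countEntropy_le_add {x y : ℝ} (hx : 0 ≤ x) (hy : 0 ≤ y) : countEntropy x y ≤ x + y := by
  rw [← mul_binEntropy_div hx hy]
  have h1 : Real.binEntropy (x / (x + y)) ≤ Real.log 2 := Real.binEntropy_le_log_two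
  have h2 := Real.log_two_lt_d9
  exact mul_le_of_le_one_right (by positivity) (by linarith)

/-- The second derivative of binary entropy is -1/(x(1-x)), which is at most -4 on the open unit
interval. -/
lemma concaveOn_binEntropy_add_sq :
    ConcaveOn ℝ (Set.Icc 0 1) (fun x : ℝ => Real.binEntropy x + 2 * x ^ 2) := by
  refine concaveOn_of_hasDerivWithinAt2_nonpos (convex_Icc 0 1)
    (f' := fun x => (Real.log (1 - x) - Real.log x) + 4 * x)
    (f'' := fun x => (-1 / (1 - x) - x⁻¹) + 4) (by fun_prop) ?_ ?_ ?_
  · intro x hx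
    rw [interior_Icc] at hx ⊢
    have h := (Real.hasDerivAt_binEntropy hx.1.ne' hx.2.ne).add ((hasDerivAt_pow 2 x).const_mul 2)
    refine (h.congr_deriv ?_).hasDerivWithinAt
    push_cast; ring
  · intro x hx
    rw [interior_Icc] at hx ⊢
    have h1 : HasDerivAt (fun y : ℝ => Real.log (1 - y)) (-1 / (1 - x)) x :=
      ((hasDerivAt_id x).const_sub 1).log (by simpa using (sub_pos.2 hx.2).ne')
    have h := (h1.sub (Real.hasDerivAt_log hx.1.ne')).add ((hasDerivAt_id x).const_mul 4)
    refine (h.congr_deriv ?_).hasDerivWithinAt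
    ring
  · intro x hx
    rw [interior_Icc] at hx
    have h0 := hx.1
    have h1 : 0 < 1 - x := sub_pos.2 hx.2
    have : (-1 / (1 - x) - x⁻¹) + 4 = -((2 * x - 1) ^ 2 / (x * (1 - x))) := by
      field_simp; ring
    rw [this]
    exact neg_nonpos.2 (by positivity)

/-- The convexity gap of 2x² at these weights is exactly the left side, so concavity after adding
2x² is equivalent to this bound. -/
lemma binEntropy_strong_concavity {q a c : ℝ} (hq : q ∈ Set.Icc (0 : ℝ) 1)
    (ha : a ∈ Set.Icc (0 : ℝ) 1) (hc : c ∈ Set.Icc (0 : ℝ) 1) :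
    2 * (q * (1 - q)) * (a - c) ^ 2 ≤ Real.binEntropy (q * a + (1 - q) * c)
      - q * Real.binEntropy a - (1 - q) * Real.binEntropy c := by
  have h := concaveOn_binEntropy_add_sq.2 ha hc hq.1 (sub_nonneg.2 hq.2) (by ring)
  simp only [smul_eq_mul] at h
  nlinarith [h]

/-- Symmetry of mutual information in the two-by-two table of label against split value. -/
lemma countEntropy_exchange (a b c d : ℝ) :
    countEntropy (a + b) (c + d) - countEntropy a c - countEntropy b d
      = countEntropy (a + c) (b + d) - countEntropy a b - countEntropy c d := by
  simp only [countEntropy, show a + c + (b + d) = a + b + (c + d) by ring]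
  ring

/-- After the exchange the gain is a concavity gap of the entropy of h, with weights the class
frequencies and points the fractions of each class on which h is 1. -/
lemma countEntropy_split_lower {a b c d : ℝ} (ha : 0 ≤ a) (hb : 0 ≤ b) (hc : 0 ≤ c) (hd : 0 ≤ d)
    (hP : 0 < a + b) (hQ : 0 < c + d) :
    2 * ((a + b) * (c + d) / (a + b + (c + d))) * (a / (a + b) - c / (c + d)) ^ 2 ≤
      countEntropy (a + b) (c + d) - countEntropy a c - countEntropy b d := by
  rw [countEntropy_exchange, ← mul_binEntropy_div (add_nonneg ha hc) (add_nonneg hb hd),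
    ← mul_binEntropy_div ha hb, ← mul_binEntropy_div hc hd]
  set P := a + b with hPdef
  set Q := c + d with hQdef
  have hs : a + c + (b + d) = P + Q := by rw [hPdef, hQdef]; ring
  rw [hs]
  have h := binEntropy_strong_concavity (q := P / (P + Q)) (a := a / P) (c := c / Q)
    ⟨by positivity, div_le_one_of_le₀ (by linarith) (by positivity)⟩
    ⟨by positivity, div_le_one_of_le₀ (by linarith) (by positivity)⟩
    ⟨by positivity, div_le_one_of_le₀ (by linarith) (by positivity)⟩
  have e1 : 1 - P / (P + Q) = Q / (P + Q) := by field_simp; ring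
  have e2 : P / (P + Q) * (a / P) + Q / (P + Q) * (c / Q) = (a + c) / (P + Q) := by
    field_simp
  rw [e1, e2] at h
  have h' := mul_le_mul_of_nonneg_left h (show 0 ≤ P + Q by positivity)
  refine le_trans (le_of_eq ?_) (h'.trans (le_of_eq ?_))
  · field_simp
  · field_simp

lemma countEntropy_split_nonneg {a b c d : ℝ} (ha : 0 ≤ a) (hb : 0 ≤ b) (hc : 0 ≤ c)
    (hd : 0 ≤ d) :
    0 ≤ countEntropy (a + b) (c + d) - countEntropy a c - countEntropy b d := by
  rcases (add_nonneg ha hb).eq_or_lt with hP | hP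
  · obtain rfl : a = 0 := by linarith
    obtain rfl : b = 0 := by linarith
    simp [countEntropy_zero_left]
  rcases (add_nonneg hc hd).eq_or_lt with hQ | hQ
  · obtain rfl : c = 0 := by linarith
    obtain rfl : d = 0 := by linarith
    simp [countEntropy_zero_right]
  exact le_trans (by positivity) (countEntropy_split_lower ha hb hc hd hP hQ)

/-- Each of the terms x log((x+y)/x) and y log((x+y)/y) contributes at least x/2. -/
lemma left_le_countEntropy {x y : ℝ} (hx : 0 ≤ x) (hxy : x ≤ y) : x ≤ countEntropy x y := by
  rcases hx.eq_or_lt with rfl | hx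
  · simp [countEntropy]
  have hy : 0 < y := hx.trans_le hxy
  have h1 : Real.log 2 ≤ Real.log (x + y) - Real.log x := by
    rw [← Real.log_div (by positivity) hx.ne']
    refine Real.log_le_log two_pos ?_
    rw [le_div_iff₀ hx]; linarith
  have h2 : x / (x + y) ≤ Real.log (x + y) - Real.log y := by
    have := Real.log_le_sub_one_of_pos (show 0 < y / (x + y) by positivity)
    rw [Real.log_div hy.ne' (by positivity)] at this
    have e : y / (x + y) - 1 = -(x / (x + y)) := by field_simp; ring
    linarith
  have h3 : x / 2 ≤ y * (x / (x + y)) := by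
    rw [mul_div_assoc', div_le_div_iff₀ two_pos (by positivity)]; nlinarith
  have h4 := Real.log_two_gt_d9
  have h5 := mul_le_mul_of_nonneg_left h1 hx.le
  have h6 := mul_le_mul_of_nonneg_left h2 hy.le
  have h7 : x * (1 / 2) ≤ x * Real.log 2 := mul_le_mul_of_nonneg_left (by linarith) hx.le
  rw [countEntropy]
  nlinarith

lemma min_le_countEntropy {x y : ℝ} (hx : 0 ≤ x) (hy : 0 ≤ y) : min x y ≤ countEntropy x y := by
  rcases le_total x y with h | h
  · rw [min_eq_left h]; exact left_le_countEntropy hx h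
  · rw [min_eq_right h, countEntropy_comm]; exact left_le_countEntropy hy h

/-- Gibbs' inequality against the distribution (m, 1-m), where log(1/(1-m)) ≤ 2m because 1/(1-m) ≤
1+2m for m ≤ 1/2. The free parameter m trades the logarithmic factor on the minority against an
error proportional to the sample size. -/
lemma countEntropy_le_left {x y m : ℝ} (hx : 0 ≤ x) (hy : 0 ≤ y) (hm : 0 < m) (hm' : m ≤ 1 / 2) :
    countEntropy x y ≤ x * Real.log (1 / m) + 2 * m * (x + y) := by
  have hlog : 0 ≤ Real.log (1 / m) := Real.log_nonneg (by rw [le_div_iff₀ hm]; linarith)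
  rcases hx.eq_or_lt with rfl | hx
  · simp only [countEntropy_zero_left]; positivity
  rcases hy.eq_or_lt with rfl | hy
  · simp only [countEntropy_zero_right]; positivity
  have h1 := Real.log_le_sub_one_of_pos (show 0 < (x + y) * m / x by positivity)
  have h2 := Real.log_le_sub_one_of_pos (show 0 < (x + y) / (y * (1 + 2 * m)) by positivity)
  rw [Real.log_div (by positivity) hx.ne', Real.log_mul (by positivity) hm.ne'] at h1
  rw [Real.log_div (by positivity) (by positivity), Real.log_mul hy.ne' (by positivity)] at h2
  have h3 : Real.log (1 + 2 * m) ≤ 2 * m := by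
    have := Real.log_le_sub_one_of_pos (show 0 < 1 + 2 * m by positivity)
    linarith
  have h4 := mul_le_mul_of_nonneg_left h1 hx.le
  have h5 := mul_le_mul_of_nonneg_left h2 hy.le
  have e1 : x * ((x + y) * m / x - 1) = (x + y) * m - x := by field_simp
  have e2 : y * ((x + y) / (y * (1 + 2 * m)) - 1) ≤ (x + y) * (1 - m) - y := by
    have : (x + y) / (1 + 2 * m) ≤ (x + y) * (1 - m) := by
      rw [div_le_iff₀ (by positivity)]
      have : 1 ≤ (1 - m) * (1 + 2 * m) := by nlinarith
      nlinarith
    have e : y * ((x + y) / (y * (1 + 2 * m)) - 1) = (x + y) / (1 + 2 * m) - y := by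
      field_simp
    linarith
  have h6 := mul_le_mul_of_nonneg_left h3 hy.le
  rw [one_div, Real.log_inv, countEntropy]
  nlinarith [mul_pos hm hx]

lemma countEntropy_le {x y m : ℝ} (hx : 0 ≤ x) (hy : 0 ≤ y) (hm : 0 < m) (hm' : m ≤ 1 / 2) :
    countEntropy x y ≤ min x y * Real.log (1 / m) + 2 * m * (x + y) := by
  rcases le_total x y with h | h
  · rw [min_eq_left h]; exact countEntropy_le_left hx hy hm hm'
  · rw [min_eq_right h, countEntropy_comm, add_comm x y]
    exact countEntropy_le_left hy hx hm hm'

/-! ### Entropy and minority of a labelled sample -/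

/-- The number of points of a sample with label `y`. -/
def labelled {X : Type*} (f : X → Bool) (A : Multiset X) (y : Bool) : ℕ :=
  A.countP (fun x => f x = y)

/-- The entropy of a sample in nats, multiplied by its size. -/
noncomputable def sampleEntropy {X : Type*} (f : X → Bool) (A : Multiset X) : ℝ :=
  countEntropy (labelled f A true) (labelled f A false)

/-- The number of points of a sample that do not carry its majority label. -/
def minority {X : Type*} (f : X → Bool) (A : Multiset X) : ℝ :=
  min (labelled f A true : ℝ) (labelled f A false)

section Sample

variable {X : Type*} (f : X → Bool)

lemma labelled_add (A : Multiset X) : labelled f A true + labelled f A false = A.card := by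
  rw [Multiset.card_eq_countP_add_countP (fun x => f x = true) A]
  simp [labelled]

lemma labelled_add_cast (A : Multiset X) :
    (labelled f A true : ℝ) + labelled f A false = A.card := by
  exact_mod_cast labelled_add f A

lemma labelled_split (A : Multiset X) (h : X → Bool) (y : Bool) :
    labelled f A y = labelled f (A.filter fun x => h x = true) y
      + labelled f (A.filter fun x => h x = false) y := by
  induction A using Multiset.induction_on with
  | empty => simp [labelled]
  | cons a s ih =>
    simp only [labelled] at ih ⊢
    by_cases h1 : h a = true <;> by_cases h2 : f a = y <;> simp [h1, h2, ih] <;> ring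

lemma card_mul_entropy (A : Multiset X) :
    (A.card : ℝ) * (entropy (posFrac f A) * Real.log 2) = sampleEntropy f A := by
  have h2 : Real.log 2 ≠ 0 := (Real.log_pos one_lt_two).ne'
  rw [entropy, div_mul_cancel₀ _ h2, sampleEntropy, ← mul_binEntropy_div (by positivity)
    (by positivity), labelled_add_cast]
  rfl

/-- Scaled by the sample size, the gain becomes a difference of entropies that add over leaves, as
the potential argument needs. -/
lemma card_mul_gain (A : Multiset X) (h : X → Bool) :
    (A.card : ℝ) * gain f A h * Real.log 2 = sampleEntropy f A
      - sampleEntropy f (A.filter fun x => h x = false)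
      - sampleEntropy f (A.filter fun x => h x = true) := by
  rw [← card_mul_entropy f A, ← card_mul_entropy f (A.filter fun x => h x = false),
    ← card_mul_entropy f (A.filter fun x => h x = true)]
  rcases eq_or_ne A 0 with rfl | hA
  · simp
  have : (A.card : ℝ) ≠ 0 := by simpa using hA
  simp only [gain]
  field_simp

lemma sampleEntropy_nonneg (A : Multiset X) : 0 ≤ sampleEntropy f A :=
  countEntropy_nonneg (by positivity) (by positivity)

lemma sampleEntropy_le_card (A : Multiset X) : sampleEntropy f A ≤ A.card :=
  (countEntropy_le_add (by positivity) (by positivity)).trans_eq (labelled_add_cast f A)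

lemma minority_le_sampleEntropy (A : Multiset X) : minority f A ≤ sampleEntropy f A :=
  min_le_countEntropy (by positivity) (by positivity)

lemma minority_le_half (A : Multiset X) : minority f A ≤ A.card / 2 := by
  have := labelled_add_cast f A
  have h1 : minority f A ≤ labelled f A true := min_le_left _ _
  have h2 : minority f A ≤ labelled f A false := min_le_right _ _
  linarith

lemma sampleEntropy_le (A : Multiset X) {m : ℝ} (hm : 0 < m) (hm' : m ≤ 1 / 2) :
    sampleEntropy f A ≤ minority f A * Real.log (1 / m) + 2 * m * A.card := by
  rw [← labelled_add_cast f A]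
  exact countEntropy_le (by positivity) (by positivity) hm hm'

lemma sampleEntropy_split_nonneg (A : Multiset X) (h : X → Bool) :
    0 ≤ sampleEntropy f A - sampleEntropy f (A.filter fun x => h x = false)
      - sampleEntropy f (A.filter fun x => h x = true) := by
  have := countEntropy_split_nonneg
    (a := labelled f (A.filter fun x => h x = true) true)
    (b := labelled f (A.filter fun x => h x = false) true)
    (c := labelled f (A.filter fun x => h x = true) false)
    (d := labelled f (A.filter fun x => h x = false) false)
    (by positivity) (by positivity) (by positivity) (by positivity)
  simp only [sampleEntropy]
  rw [labelled_split f A h true, labelled_split f A h false]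
  push_cast
  linarith

lemma gain_nonneg (A : Multiset X) (h : X → Bool) : 0 ≤ gain f A h := by
  rcases eq_or_ne A 0 with rfl | hA
  · simp [gain, posFrac, entropy]
  have hc : (0 : ℝ) < A.card := by exact_mod_cast Multiset.card_pos.2 hA
  have h2 : 0 < Real.log 2 := Real.log_pos one_lt_two
  have := sampleEntropy_split_nonneg f A h
  rw [← card_mul_gain] at this
  by_contra hneg
  push Not at hneg
  have : (A.card : ℝ) * gain f A h * Real.log 2 < 0 :=
    mul_neg_of_neg_of_pos (mul_neg_of_pos_of_neg hc hneg) h2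
  linarith

lemma entropy_posFrac_nonneg (A : Multiset X) : 0 ≤ entropy (posFrac f A) := by
  refine div_nonneg (Real.binEntropy_nonneg (by unfold posFrac; positivity) ?_)
    (Real.log_nonneg one_le_two)
  refine div_le_one_of_le₀ ?_ (by positivity)
  exact_mod_cast Multiset.countP_le_card _ _

lemma gain_le_one (A : Multiset X) (h : X → Bool) : gain f A h ≤ 1 := by
  have h1 : entropy (posFrac f A) ≤ 1 :=
    div_le_one_of_le₀ Real.binEntropy_le_log_two (Real.log_nonneg one_le_two)
  have h2 : ∀ A' : Multiset X, 0 ≤ (A'.card : ℝ) / A.card * entropy (posFrac f A') := fun A' =>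
    mul_nonneg (by positivity) (entropy_posFrac_nonneg f A')
  have h3 := h2 (A.filter fun x => h x = false)
  have h4 := h2 (A.filter fun x => h x = true)
  simp only [gain]
  linarith

end Sample

/-! ### Consequences of weak learning -/

section Weak

variable {X : Type*} [MeasurableSpace X] {f : X → Bool} {H : Set (X → Bool)} {γ : ℝ}

/-- The error on a point mass is nonnegative. -/
lemma WeakLearning.le_half (hW : WeakLearning f H γ) (x : X) : γ ≤ 1 / 2 := by
  obtain ⟨h, -, hh⟩ := hW (Measure.dirac x) inferInstance
  linarith [measureReal_nonneg (μ := Measure.dirac x) (s := {x | h x ≠ f x})]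

/-- Weak learning for the distribution that gives mass `u` to every point of `A` with label one and
mass `v` to every point with label zero. -/
lemma WeakLearning.exists_weighted (hW : WeakLearning f H γ) (A : Multiset X) {u v : ℝ}
    (hu : 0 ≤ u) (hv : 0 ≤ v) (huv : labelled f A true * u + labelled f A false * v = 1) :
    ∃ h ∈ H, labelled f (A.filter fun x => h x = false) true * u
      + labelled f (A.filter fun x => h x = true) false * v ≤ 1 / 2 - γ := by
  classical
  let c : X → ℝ := fun x => if f x = true then u else v
  have hc : ∀ x, 0 ≤ c x := fun x => by dsimp only [c]; split_ifs <;> assumption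
  have key : ∀ (B : Multiset X), (B.map fun x => c x).sum
      = labelled f B true * u + labelled f B false * v := by
    intro B
    induction B using Multiset.induction_on with
    | empty => simp [labelled]
    | cons a s ih =>
      rw [Multiset.map_cons, Multiset.sum_cons, ih]
      cases hfa : f a <;> simp [labelled, c, hfa] <;> ring
  have hsum : ∀ B : Multiset X, 0 ≤ (B.map c).sum := fun B =>
    Multiset.sum_nonneg fun y hy => by
      obtain ⟨x, -, rfl⟩ := Multiset.mem_map.1 hy
      exact hc x
  let m : Multiset X → Measure X := fun B =>
    (B.map fun x => ENNReal.ofReal (c x) • Measure.dirac x).sum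
  -- Only an inequality is claimed: the sigma-algebra on X is arbitrary, the disagreement set need
  -- not be measurable, and a Dirac measure may then exceed the indicator. This direction is the one
  -- needed.
  have hm : ∀ (B : Multiset X) (p : X → Prop) [DecidablePred p],
      ENNReal.ofReal ((B.filter p).map c).sum ≤ m B {x | p x} := by
    intro B p _
    induction B using Multiset.induction_on with
    | empty => simp [m]
    | cons a t ih =>
      have e : m (a ::ₘ t) {x | p x}
          = ENNReal.ofReal (c a) * Measure.dirac a {x | p x} + m t {x | p x} := by
        simp [m]
      rw [e]
      by_cases ha : p a
      · rw [Multiset.filter_cons_of_pos _ ha, Multiset.map_cons, Multiset.sum_cons,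
          ENNReal.ofReal_add (hc a) (hsum _)]
        gcongr
        have h1 : (1 : ENNReal) ≤ Measure.dirac a {x | p x} := by
          simpa only [Set.indicator_of_mem (show a ∈ {x | p x} from ha), Pi.one_apply] using
            Measure.le_dirac_apply (a := a) (s := {x | p x})
        exact le_mul_of_one_le_right' h1
      · rw [Multiset.filter_cons_of_neg _ ha]
        exact ih.trans le_add_self
  have hm1 : m A Set.univ = 1 := by
    have : ∀ B : Multiset X, m B Set.univ = ENNReal.ofReal (B.map c).sum := by
      intro B
      induction B using Multiset.induction_on with
      | empty => simp [m]
      | cons a t ih =>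
        have e : m (a ::ₘ t) Set.univ = ENNReal.ofReal (c a) + m t Set.univ := by
          simp [m]
        rw [e, ih, Multiset.map_cons, Multiset.sum_cons,
          ENNReal.ofReal_add (hc a) (hsum _)]
    rw [this, key, huv, ENNReal.ofReal_one]
  have hprob : IsProbabilityMeasure (m A) := ⟨hm1⟩
  obtain ⟨h, hH, hh⟩ := hW (m A) hprob
  refine ⟨h, hH, le_trans ?_ hh⟩
  have h1 := hm A (fun x => h x ≠ f x)
  rw [ENNReal.ofReal_le_iff_le_toReal (measure_ne_top _ _)] at h1
  refine le_trans (le_of_eq ?_) h1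
  rw [key]
  congr 2
  · congr 1
    simp only [labelled, Multiset.countP_filter]
    refine Multiset.countP_congr rfl fun x _ => ?_
    cases h x <;> cases f x <;> simp
  · congr 1
    simp only [labelled, Multiset.countP_filter]
    refine Multiset.countP_congr rfl fun x _ => ?_
    cases h x <;> cases f x <;> simp

/-- Under weak learning some split decreases the entropy of a sample by `4γ²` times the size of its
minority. -/
lemma WeakLearning.exists_split (hW : WeakLearning f H γ) (hγ : 0 < γ) (A : Multiset X)
    (hA : 0 < minority f A) :
    ∃ h ∈ H, 4 * γ ^ 2 * minority f A ≤ sampleEntropy f A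
      - sampleEntropy f (A.filter fun x => h x = false)
      - sampleEntropy f (A.filter fun x => h x = true) := by
  have hP : (0 : ℝ) < labelled f A true := hA.trans_le (min_le_left _ _)
  have hQ : (0 : ℝ) < labelled f A false := hA.trans_le (min_le_right _ _)
  -- These weights give each label class total mass 1/2.
  obtain ⟨h, hH, hh⟩ := hW.exists_weighted A (u := 1 / (2 * labelled f A true))
    (v := 1 / (2 * labelled f A false)) (by positivity) (by positivity) (by field_simp; norm_num)
  refine ⟨h, hH, ?_⟩
  have eP := labelled_split f A h true
  have eQ := labelled_split f A h false
  simp only [sampleEntropy, minority]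
  rw [minority] at hA
  simp only [eP, eQ] at hA hh hP hQ ⊢
  clear eP eQ
  generalize labelled f (A.filter fun x => h x = true) true = a at *
  generalize labelled f (A.filter fun x => h x = false) true = b at *
  generalize labelled f (A.filter fun x => h x = true) false = c at *
  generalize labelled f (A.filter fun x => h x = false) false = d at *
  push_cast at hh hP hQ hA ⊢
  have hlow := countEntropy_split_lower (a := (a : ℝ)) (b := b) (c := c) (d := d)
    (by positivity) (by positivity) (by positivity) (by positivity) hP hQ
  set P : ℝ := (a : ℝ) + b with hPdef
  set Q : ℝ := (c : ℝ) + d with hQdef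
  -- With balanced classes the error of h is 1/2 - (a/P - c/Q)/2, so an advantage γ is a frequency
  -- gap of 2γ.
  have hgap : 2 * γ ≤ a / P - c / Q := by
    have e1 : (b : ℝ) * (1 / (2 * P)) = 1 / 2 - a / P / 2 := by
      rw [show (b : ℝ) = P - a by rw [hPdef]; ring]; field_simp
    have e2 : (c : ℝ) * (1 / (2 * Q)) = c / Q / 2 := by field_simp
    rw [e1, e2] at hh
    linarith
  have hsq : (2 * γ) ^ 2 ≤ (a / P - c / Q) ^ 2 := by
    exact pow_le_pow_left₀ (by positivity) hgap 2
  have hmin : min P Q / 2 ≤ P * Q / (P + Q) := by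
    rw [div_le_div_iff₀ two_pos (by positivity)]
    rcases le_total P Q with hle | hle
    · rw [min_eq_left hle]; nlinarith
    · rw [min_eq_right hle]; nlinarith
  have : 2 * (min P Q / 2) * (2 * γ) ^ 2 ≤ 2 * (P * Q / (P + Q)) * (a / P - c / Q) ^ 2 :=
    mul_le_mul (by linarith) hsq (by positivity) (by positivity)
  calc 4 * γ ^ 2 * min P Q = 2 * (min P Q / 2) * (2 * γ) ^ 2 := by ring
    _ ≤ _ := this
    _ ≤ _ := hlow
    _ = _ := by ring

end Weak

/-! ### The Laplace distribution -/

lemma setLIntegral_exp_neg_Ioi (c : ℝ) :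
    ∫⁻ x in Set.Ioi c, ENNReal.ofReal (Real.exp (-x)) = ENNReal.ofReal (Real.exp (-c)) := by
  rw [← ofReal_integral_eq_lintegral_ofReal (integrableOn_exp_neg_Ioi c)
    (Filter.Eventually.of_forall fun x => (Real.exp_pos _).le), integral_exp_neg_Ioi]

lemma setLIntegral_laplace_Ioi {c : ℝ} (hc : 0 ≤ c) :
    ∫⁻ x in Set.Ioi c, ENNReal.ofReal (Real.exp (-|x|) / 2)
      = ENNReal.ofReal (Real.exp (-c)) / 2 := by
  rw [← setLIntegral_exp_neg_Ioi, div_eq_mul_inv, ← lintegral_mul_const' _ _ (by simp)]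
  refine setLIntegral_congr_fun measurableSet_Ioi fun x hx => ?_
  rw [abs_of_nonneg (hc.trans (le_of_lt hx)), ENNReal.ofReal_div_of_pos two_pos, div_eq_mul_inv,
    ENNReal.ofReal_ofNat]

lemma setLIntegral_laplace_Iio {c : ℝ} (hc : 0 ≤ c) :
    ∫⁻ x in Set.Iio (-c), ENNReal.ofReal (Real.exp (-|x|) / 2)
      = ENNReal.ofReal (Real.exp (-c)) / 2 := by
  rw [← setLIntegral_laplace_Ioi hc,
    ← (Measure.measurePreserving_neg (volume : Measure ℝ)).setLIntegral_comp_preimage_emb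
      (Homeomorph.neg ℝ).measurableEmbedding (fun x => ENNReal.ofReal (Real.exp (-|x|) / 2))
      (Set.Ioi c)]
  simp

lemma measurableSet_lt_abs (c : ℝ) : MeasurableSet {x : ℝ | c < |x|} :=
  measurableSet_lt measurable_const measurable_norm

lemma laplace_tail {c : ℝ} (hc : 0 ≤ c) :
    laplace {x | c < |x|} = ENNReal.ofReal (Real.exp (-c)) := by
  have hset : {x : ℝ | c < |x|} = Set.Iio (-c) ∪ Set.Ioi c := by
    ext x; simp only [Set.mem_ofPred_eq, lt_abs, Set.mem_union, Set.mem_Iio, Set.mem_Ioi]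
    constructor <;> rintro (h | h) <;> [right; left; right; left] <;> linarith
  have hd : Disjoint (Set.Iio (-c)) (Set.Ioi c) :=
    Set.disjoint_left.2 fun x h1 h2 => by
      rw [Set.mem_Iio] at h1; rw [Set.mem_Ioi] at h2; linarith
  rw [laplace, withDensity_apply _ (measurableSet_lt_abs c), hset,
    lintegral_union measurableSet_Ioi hd, setLIntegral_laplace_Iio hc, setLIntegral_laplace_Ioi hc,
    ENNReal.add_halves]

instance isProbabilityMeasure_laplace : IsProbabilityMeasure laplace := by
  refine ⟨?_⟩
  -- The tail formula at 0 gives the total mass up to the null set {0}.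
  have h : laplace {x | (0 : ℝ) < |x|} = 1 := by rw [laplace_tail le_rfl]; simp
  have h0 : laplace {0} = 0 := by
    rw [laplace, withDensity_apply _ (measurableSet_singleton 0)]; simp
  refine le_antisymm ?_ (h ▸ measure_mono (Set.subset_univ _))
  calc laplace Set.univ ≤ laplace ({x | (0 : ℝ) < |x|} ∪ {0}) := by
        refine measure_mono fun x _ => ?_
        by_cases hx : x = 0 <;> simp [hx]
    _ ≤ laplace {x | (0 : ℝ) < |x|} + laplace {0} := measure_union_le _ _
    _ = 1 := by rw [h, h0, add_zero]

/-! ### Noise of a run -/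

variable {k : ℕ} {Ω : Type*} [MeasurableSpace Ω] (P : Measure Ω) [IsProbabilityMeasure P]

/-- The law of the randomness used at one node. -/
noncomputable abbrev seedMeasure (k : ℕ) {Ω : Type*} [MeasurableSpace Ω] (P : Measure Ω) :
    Measure (Seed k Ω) :=
  P.prod ((Measure.pi fun _ => laplace).prod (Measure.pi fun _ => Measure.pi fun _ => laplace))

lemma seedMeasure_weight_tail (i : Fin k) {c : ℝ} (hc : 0 ≤ c) :
    seedMeasure k P {y | c < |y.2.1 i|} = ENNReal.ofReal (Real.exp (-c)) := by
  have h1 := (measurePreserving_eval (fun _ : Fin k => laplace) i).comp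
    ((measurePreserving_fst (μ := Measure.pi fun _ : Fin k => laplace)
      (ν := Measure.pi fun _ : Bool => Measure.pi fun _ : Fin k => laplace)).comp
      (measurePreserving_snd (μ := P)))
  rw [← laplace_tail hc, ← h1.measure_preimage (measurableSet_lt_abs c).nullMeasurableSet]
  rfl

lemma seedMeasure_label_tail (y : Bool) (i : Fin k) {c : ℝ} (hc : 0 ≤ c) :
    seedMeasure k P {z | c < |z.2.2 y i|} = ENNReal.ofReal (Real.exp (-c)) := by
  have h1 := (measurePreserving_eval (fun _ : Fin k => laplace) i).comp
    ((measurePreserving_eval (fun _ : Bool => Measure.pi fun _ : Fin k => laplace) y).comp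
    ((measurePreserving_snd (μ := Measure.pi fun _ : Fin k => laplace)
      (ν := Measure.pi fun _ : Bool => Measure.pi fun _ : Fin k => laplace)).comp
      (measurePreserving_snd (μ := P))))
  rw [← laplace_tail hc, ← h1.measure_preimage (measurableSet_lt_abs c).nullMeasurableSet]
  rfl

/-- The seeds of a node whose Laplace variables are all bounded by `c`. -/
def quietSeeds (k : ℕ) (Ω : Type*) (c : ℝ) : Set (Seed k Ω) :=
  {z | (∀ i, |z.2.1 i| ≤ c) ∧ ∀ y i, |z.2.2 y i| ≤ c}

/-- A union bound over 3k variables per node: k for the weight and 2k for the two label counts. -/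
lemma seedMeasure_quiet {c : ℝ} (hc : 0 ≤ c) :
    seedMeasure k P (quietSeeds k Ω c)ᶜ ≤ ENNReal.ofReal (3 * k * Real.exp (-c)) := by
  have hsub : (quietSeeds k Ω c)ᶜ ⊆ (⋃ i : Fin k, {z : Seed k Ω | c < |z.2.1 i|}) ∪
      ⋃ q : Bool × Fin k, {z : Seed k Ω | c < |z.2.2 q.1 q.2|} := by
    intro z hz
    simp only [quietSeeds, Set.mem_compl_iff, Set.mem_ofPred_eq, not_and_or, not_forall,
      not_le] at hz
    rcases hz with ⟨i, hi⟩ | ⟨y, i, hi⟩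
    · exact Or.inl (Set.mem_iUnion.2 ⟨i, hi⟩)
    · exact Or.inr (Set.mem_iUnion.2 ⟨(y, i), hi⟩)
  refine (measure_mono hsub).trans ((measure_union_le _ _).trans ?_)
  refine (add_le_add (measure_iUnion_le _) (measure_iUnion_le _)).trans ?_
  simp only [seedMeasure_weight_tail P _ hc, seedMeasure_label_tail P _ _ hc, tsum_fintype,
    Finset.sum_const, Finset.card_univ, Fintype.card_fin, Fintype.card_prod, Fintype.card_bool,
    nsmul_eq_mul]
  rw [ENNReal.ofReal_mul (by positivity), ENNReal.ofReal_mul (by positivity),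
    ENNReal.ofReal_natCast, ENNReal.ofReal_ofNat]
  push_cast
  rw [← add_mul]
  refine le_of_eq ?_
  congr 1
  ring

/-! ### Functions with measurable fibres -/

/-- All fibres of `g` are measurable. -/
def FiberMeasurable {Y C : Type*} [MeasurableSpace Y] (g : Y → C) : Prop :=
  ∀ c, MeasurableSet {y | g y = c}

section Fiber

variable {Y A C : Type*} [MeasurableSpace Y]

lemma FiberMeasurable.const (c : C) : FiberMeasurable (fun _ : Y => c) := fun _ =>
  MeasurableSet.const _

/-- The countably many values of the intermediate result split each fibre into measurable pieces;
this makes a run of the algorithm tractable one decision at a time. -/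
lemma FiberMeasurable.bind [Countable A] {g : Y → A} (hg : FiberMeasurable g) {F : A → Y → C}
    (hF : ∀ a, FiberMeasurable (F a)) : FiberMeasurable (fun y => F (g y) y) := by
  intro c
  have : {y | F (g y) y = c} = ⋃ a, {y | g y = a} ∩ {y | F a y = c} := by
    ext y; simp
  rw [this]
  exact MeasurableSet.iUnion fun a => (hg a).inter (hF a c)

lemma FiberMeasurable.map [Countable A] {g : Y → A} (hg : FiberMeasurable g) (φ : A → C) :
    FiberMeasurable (fun y => φ (g y)) :=
  hg.bind fun a => FiberMeasurable.const (φ a)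

lemma FiberMeasurable.ite {p : Y → Prop} [DecidablePred p] (hp : MeasurableSet {y | p y})
    (a b : C) : FiberMeasurable (fun y => if p y then a else b) := by
  intro c
  have : {y | (if p y then a else b) = c}
      = {y | p y} ∩ {_y | a = c} ∪ {y | p y}ᶜ ∩ {_y | b = c} := by
    ext y; by_cases h : p y <;> simp [h]
  rw [this]
  exact (hp.inter (MeasurableSet.const _)).union (hp.compl.inter (MeasurableSet.const _))

/-- `List.argmax` returns the earliest maximizer, so each fibre is cut out by finitely many
comparisons, including those for ties. -/
lemma FiberMeasurable.argmax (l : List A) {F : A → Y → ℝ}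
    (hF : ∀ a, Measurable (F a)) : FiberMeasurable (fun y => l.argmax fun a => F a y) := by
  classical
  rintro (_ | m)
  · simp only [List.argmax_eq_none]
    exact MeasurableSet.const _
  · simp only [List.argmax_eq_some_iff]
    refine (MeasurableSet.const _).inter (MeasurableSet.inter ?_ ?_)
    · have : {y | ∀ a ∈ l, F a y ≤ F m y} = ⋂ a ∈ {a | a ∈ l}, {y | F a y ≤ F m y} := by
        ext y; simp
      change MeasurableSet {y | ∀ a ∈ l, F a y ≤ F m y}
      rw [this]
      exact MeasurableSet.biInter (List.finite_toSet l).countable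
        fun a _ => measurableSet_le (hF a) (hF m)
    · have : {y | ∀ a ∈ l, F m y ≤ F a y → l.idxOf m ≤ l.idxOf a}
          = ⋂ a ∈ {a | a ∈ l}, {y | F m y ≤ F a y}ᶜ ∪ {_y | l.idxOf m ≤ l.idxOf a} := by
        ext y; simp [imp_iff_not_or]
      change MeasurableSet {y | ∀ a ∈ l, F m y ≤ F a y → l.idxOf m ≤ l.idxOf a}
      rw [this]
      exact MeasurableSet.biInter (List.finite_toSet l).countable
        fun a _ => (measurableSet_le (hF m) (hF a)).compl.union (MeasurableSet.const _)

end Fiber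

/-- If `g` takes countably many values and does not depend on the coordinate `i`, then the
coordinate `i` falls into the set chosen by `g` with at most the largest probability of these
sets. -/
lemma measure_pi_fresh_le {ι Y C : Type*} [Fintype ι] [MeasurableSpace Y] (ν : Measure Y)
    [IsProbabilityMeasure ν] [Countable C] (i : ι) {g : (ι → Y) → C} (hg : FiberMeasurable g)
    (hdep : ∀ ω ω' : ι → Y, (∀ j, j ≠ i → ω j = ω' j) → g ω = g ω') {Bad : C → Set Y}
    (hBad : ∀ c, MeasurableSet (Bad c)) {b : ENNReal} (hb : ∀ c, ν (Bad c) ≤ b) :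
    Measure.pi (fun _ : ι => ν) {ω | ω i ∈ Bad (g ω)} ≤ b := by
  classical
  set μ := Measure.pi (fun _ : ι => ν) with hμ
  have hind : ProbabilityTheory.iIndepFun (fun (j : ι) (ω : ι → Y) => ω j) μ :=
    ProbabilityTheory.iIndepFun_pi (X := fun _ : ι => (id : Y → Y)) fun _ => aemeasurable_id
  have hind2 := hind.indepFun_finset {i} (Finset.univ.erase i) (by simp)
    (fun j => measurable_pi_apply j)
  -- On each cell of g the chosen set is constant, and the cell is independent of the coordinate i.
  have hcell : ∀ c, μ ({ω | g ω = c} ∩ {ω | ω i ∈ Bad c}) = μ {ω | g ω = c} * ν (Bad c) := by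
    intro c
    have hY : Nonempty Y := ν.nonempty_of_neZero
    obtain ⟨y₀⟩ := hY
    -- Filling the missing coordinate with an arbitrary value leaves g unchanged, which exhibits the
    -- cell as an event in the other coordinates.
    let ext : ({j : ι // j ∈ Finset.univ.erase i} → Y) → (ι → Y) := fun ω j =>
      if h : j ∈ Finset.univ.erase i then ω ⟨j, h⟩ else y₀
    have hext : Measurable ext := by
      refine measurable_pi_lambda _ fun j => ?_
      by_cases h : j ∈ Finset.univ.erase i
      · simp only [ext, h, dif_pos]; exact measurable_pi_apply _
      · simp only [ext, h, dif_neg, not_false_eq_true]; exact measurable_const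
    have h := hind2.measure_inter_preimage_eq_mul
      {y : ({i} : Finset ι) → Y | y ⟨i, Finset.mem_singleton_self i⟩ ∈ Bad c}
      (ext ⁻¹' {ω | g ω = c}) (measurable_pi_apply _ (hBad c)) (hext (hg c))
    have e1 : (fun (ω : ι → Y) (j : (Finset.univ.erase i : Finset ι)) => ω j) ⁻¹'
        (ext ⁻¹' {ω | g ω = c}) = {ω | g ω = c} := by
      ext1 ω
      change g _ = c ↔ g ω = c
      rw [hdep _ ω]
      intro j hj
      simp [ext, hj]
    have e2 : (fun (ω : ι → Y) (j : ({i} : Finset ι)) => ω j) ⁻¹'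
        {y : ({i} : Finset ι) → Y | y ⟨i, Finset.mem_singleton_self i⟩ ∈ Bad c}
        = {ω | ω i ∈ Bad c} := rfl
    rw [e1, e2] at h
    have e3 : μ {ω | ω i ∈ Bad c} = ν (Bad c) :=
      (measurePreserving_eval (fun _ : ι => ν) i).measure_preimage (hBad c).nullMeasurableSet
    rw [Set.inter_comm, h, e3, mul_comm]
  have hset : {ω | ω i ∈ Bad (g ω)} = ⋃ c, {ω | g ω = c} ∩ {ω | ω i ∈ Bad c} := by
    ext ω; simp
  rw [hset]
  refine (measure_iUnion_le _).trans ?_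
  simp only [hcell]
  calc ∑' c, μ {ω | g ω = c} * ν (Bad c) ≤ ∑' c, μ {ω | g ω = c} * b :=
        ENNReal.tsum_le_tsum fun c => mul_le_mul_right (hb c) _
    _ = (∑' c, μ {ω | g ω = c}) * b := ENNReal.tsum_mul_right
    _ = μ (⋃ c, {ω | g ω = c}) * b := by
        rw [measure_iUnion (fun c c' hcc => Set.disjoint_left.2 fun ω h1 h2 =>
          hcc (h1.symm.trans h2)) hg]
    _ ≤ 1 * b := mul_le_mul_left prob_le_one _
    _ = b := one_mul b

/-- Maximizers commute with maps that respect the objective. -/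
lemma argmax_map_of_eq {α β : Type*} (l : List α) (g : α → β) {F : α → ℝ} {G : β → ℝ}
    (h : ∀ a ∈ l, F a = G (g a)) : (l.map g).argmax G = (l.argmax F).map g := by
  induction l using List.reverseRecOn with
  | nil => simp
  | append_singleton l a ih =>
    have ih' := ih fun b hb => h b (by simp [hb])
    rw [List.map_append, List.map_singleton, List.argmax_concat, List.argmax_concat, ih']
    cases hl : l.argmax F with
    | none => simp
    | some c =>
      have hc : c ∈ l := List.argmax_mem hl
      simp only [Option.map_some, ← h c (by simp [hc]), ← h a (by simp)]
      split_ifs <;> rfl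

/-! ### Data at the nodes of a growing tree -/

section Trees

variable {X : Type*} {H : Set (X → Bool)}

lemma DTree.eval_split {L : Type} [DecidableEq L] (T : DTree H L) (ℓ ℓ₀ ℓ₁ : L) (h : H) (x : X) :
    (T.split ℓ h ℓ₀ ℓ₁).eval x
      = if T.eval x = ℓ then (if h.1 x = true then ℓ₁ else ℓ₀) else T.eval x := by
  induction T with
  | leaf a => by_cases ha : a = ℓ <;> simp [DTree.split, DTree.eval, ha]
  | node g l r ihl ihr =>
    simp only [DTree.split, DTree.eval]
    split_ifs at ihl ihr ⊢ <;> assumption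

lemma DTree.eval_map {L L' : Type} (g : L → L') (T : DTree H L) (x : X) :
    (T.map g).eval x = g (T.eval x) := by
  induction T with
  | leaf a => rfl
  | node h l r ihl ihr => simp only [DTree.map, DTree.eval, ihl, ihr]; split_ifs <;> rfl

lemma Dataset.total_restrict {k : ℕ} (D : Dataset X k) (R : X → Prop) [DecidablePred R] :
    (D.restrict R).total = D.total.filter R := by
  simp only [Dataset.total, Dataset.restrict]
  induction (Finset.univ : Finset (Fin k)) using Finset.cons_induction with
  | empty => simp
  | cons i s hi ih => rw [Finset.sum_cons, Finset.sum_cons, Multiset.filter_add, ih]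

lemma Dataset.size_eq_sum {k : ℕ} (D : Dataset X k) : D.size = ∑ i, (D i).card := by
  simp [Dataset.size, Dataset.total]

lemma Dataset.mem_total_of_mem {k : ℕ} {D : Dataset X k} {i : Fin k} {x : X} (hx : x ∈ D i) :
    x ∈ D.total :=
  Multiset.mem_of_le (Finset.single_le_sum (f := D) (fun _ _ => Multiset.zero_le _)
    (Finset.mem_univ i)) hx

end Trees

/-! ### The call of `PrivateSplit` at a node -/

section Calls

variable {X : Type*} {H : Set (X → Bool)} {k : ℕ} {Ω : Type*} (p : Params)
  (S : Dataset X k) (PS : SplitMechanism H k Ω)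

/-- The privacy budget of the call of `PrivateSplit` at a node of depth `d`. -/
noncomputable def callBudget (ℓ : Node p) (d : ℕ) : ℝ :=
  -- The root has depth 0 but is charged to B(1), and it keeps the whole share since no weight
  -- estimate is made there. This lets root and children be treated uniformly.
  if ℓ = 0 then p.α / 2 * p.B 1 else p.α / 2 * p.B d / 2

/-- The outcome of the call of `PrivateSplit` at a node. -/
noncomputable def nodeCall (D : Dataset X k) (ℓ : Node p) (d : ℕ) (z : Seed k Ω) : H × ℝ :=
  PS D (callBudget p ℓ d) (callDelta p) z.1

/-- The weight estimate at a node; the root has weight one. -/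
noncomputable def nodeWeight (D : Dataset X k) (ℓ : Node p) (d : ℕ) (z : Seed k Ω) : ℝ :=
  if ℓ = 0 then 1 else weightEstimate S D (p.α / 2 * p.B d) z.2.1

/-- The priority of a node. -/
noncomputable def nodePriority (D : Dataset X k) (ℓ : Node p) (d : ℕ) (z : Seed k Ω) : ℝ :=
  nodeWeight p S D ℓ d z * (nodeCall p PS D ℓ d z).2

variable {p}

/-- The first child created by the `t`-th split. -/
def childLeft (t : Fin p.M) : Node p := ⟨2 * t.1 + 1, by have := t.2; omega⟩

/-- The second child created by the `t`-th split. -/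
def childRight (t : Fin p.M) : Node p := ⟨2 * t.1 + 2, by have := t.2; omega⟩

lemma childLeft_ne_zero (t : Fin p.M) : childLeft t ≠ 0 := by
  simp [childLeft, Fin.ext_iff]

lemma childRight_ne_zero (t : Fin p.M) : childRight t ≠ 0 := by
  simp [childRight, Fin.ext_iff]

lemma childLeft_ne_childRight (t : Fin p.M) : childLeft t ≠ childRight t := by
  simp [childLeft, childRight, Fin.ext_iff]

variable (p) {PS} (ω ω' : Node p → Seed k Ω)

lemma mem_newEntries {T : DTree H (Node p)} {ℓ : Node p} (hℓ : ℓ ≠ 0) {d : ℕ} {e : Entry H p} :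
    e ∈ newEntries p S PS ω T ℓ d ↔
      p.ε / p.M ≤ nodeWeight p S (leafData S T ℓ) ℓ d (ω ℓ) ∧
      e = ⟨ℓ, d, (nodeCall p PS (leafData S T ℓ) ℓ d (ω ℓ)).1,
        nodePriority p S PS (leafData S T ℓ) ℓ d (ω ℓ)⟩ := by
  simp only [newEntries, nodePriority, nodeWeight, nodeCall, callBudget, if_neg hℓ]
  split_ifs with h <;> simp [h]

lemma newEntries_congr {T : DTree H (Node p)} {ℓ : Node p} {d : ℕ} (h : ω ℓ = ω' ℓ) :
    newEntries p S PS ω T ℓ d = newEntries p S PS ω' T ℓ d := by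
  simp only [newEntries, h]

lemma step_of_none (t : Fin p.M) {s : State H p} (h : s.queue.argmax Entry.priority = none) :
    step p S PS ω t s = s := by
  simp only [step, h]

lemma step_of_some (t : Fin p.M) {s : State H p} {e : Entry H p}
    (h : s.queue.argmax Entry.priority = some e) :
    step p S PS ω t s =
      { tree := s.tree.split e.leaf e.split (childLeft t) (childRight t)
        queue := s.queue.filter (fun e' => e'.leaf ≠ e.leaf)
          ++ newEntries p S PS ω (s.tree.split e.leaf e.split (childLeft t) (childRight t))
            (childLeft t) (e.depth + 1)
          ++ newEntries p S PS ω (s.tree.split e.leaf e.split (childLeft t) (childRight t))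
            (childRight t) (e.depth + 1) } := by
  simp only [step, h]
  rfl

lemma step_congr (t : Fin p.M) (s : State H p) (h0 : ω (childLeft t) = ω' (childLeft t))
    (h1 : ω (childRight t) = ω' (childRight t)) :
    step p S PS ω t s = step p S PS ω' t s := by
  cases h : s.queue.argmax Entry.priority with
  | none => rw [step_of_none p S ω t h, step_of_none p S ω' t h]
  | some e =>
    rw [step_of_some p S ω t h, step_of_some p S ω' t h, newEntries_congr p S ω ω' h0,
      newEntries_congr p S ω ω' h1]

/-- The first t iterations name only the nodes 0, …, 2t. Hence the seeds of the two nodes created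
next are still fresh. -/
lemma stateAfter_congr (t : ℕ) (ht : t ≤ p.M) (h : ∀ j : Node p, j.1 ≤ 2 * t → ω j = ω' j) :
    stateAfter p S PS ω t ht = stateAfter p S PS ω' t ht := by
  induction t with
  | zero => simp only [stateAfter, initState, h 0 (by simp)]
  | succ t ih =>
    simp only [stateAfter]
    rw [ih _ fun j hj => h j (by omega)]
    exact step_congr p S ω ω' _ _ (h _ (by simp only [childLeft]; omega))
      (h _ (by simp only [childRight]; omega))

variable {p} {ω}

lemma leafData_split_of_ne (T : DTree H (Node p)) {ℓ ℓ' ℓ₀ ℓ₁ : Node p} (h : H) (h1 : ℓ' ≠ ℓ)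
    (h2 : ℓ' ≠ ℓ₀) (h3 : ℓ' ≠ ℓ₁) :
    leafData S (T.split ℓ h ℓ₀ ℓ₁) ℓ' = leafData S T ℓ' := by
  funext i
  refine Multiset.filter_congr fun x _ => ?_
  rw [DTree.eval_split]
  split_ifs with h4 h5
  · simp [h4, h1.symm, h3.symm]
  · simp [h4, h1.symm, h2.symm]
  · rfl

variable (p PS ω)

/-- What is known about the state after `t` splits: only the names `0, …, 2t` have been used, and
the elements of the queue are what the calls at their leaves returned. -/
structure State.Coherent (t : ℕ) (s : State H p) : Prop where
  eval_le : ∀ x, (s.tree.eval x).1 ≤ 2 * t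
  leaf_le : ∀ e ∈ s.queue, e.leaf.1 ≤ 2 * t
  depth_le : ∀ e ∈ s.queue, e.depth ≤ t
  depth_pos : ∀ e ∈ s.queue, e.leaf ≠ 0 → 1 ≤ e.depth
  split_eq : ∀ e ∈ s.queue,
    e.split = (nodeCall p PS (leafData S s.tree e.leaf) e.leaf e.depth (ω e.leaf)).1
  priority_eq : ∀ e ∈ s.queue,
    e.priority = nodePriority p S PS (leafData S s.tree e.leaf) e.leaf e.depth (ω e.leaf)
  weight_le : ∀ e ∈ s.queue, e.leaf ≠ 0 →
    p.ε / p.M ≤ nodeWeight p S (leafData S s.tree e.leaf) e.leaf e.depth (ω e.leaf)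

lemma leafData_leaf (ℓ : Node p) : leafData S (DTree.leaf (H := H) ℓ) ℓ = S := by
  funext i
  simp [leafData, Dataset.restrict, DTree.eval]

lemma coherent_initState : State.Coherent p S PS ω 0 (initState p S PS ω) := by
  constructor <;>
    simp [initState, DTree.eval, leafData_leaf, nodePriority, nodeWeight, nodeCall, callBudget]

variable {p S PS ω}

/-- Induction principle for queue invariants: entries surviving the pop, and children whose
estimated weight passes the threshold. -/
lemma forall_mem_step_queue {t : Fin p.M} {s : State H p} {e : Entry H p}
    (h : s.queue.argmax Entry.priority = some e) {Q : Entry H p → Prop}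
    (hold : ∀ e' ∈ s.queue, e'.leaf ≠ e.leaf → Q e')
    (hnew : ∀ ℓ, ℓ = childLeft t ∨ ℓ = childRight t →
      p.ε / p.M ≤ nodeWeight p S (leafData S (step p S PS ω t s).tree ℓ) ℓ (e.depth + 1) (ω ℓ) →
      Q ⟨ℓ, e.depth + 1,
        (nodeCall p PS (leafData S (step p S PS ω t s).tree ℓ) ℓ (e.depth + 1) (ω ℓ)).1,
        nodePriority p S PS (leafData S (step p S PS ω t s).tree ℓ) ℓ (e.depth + 1) (ω ℓ)⟩) :
    ∀ e' ∈ (step p S PS ω t s).queue, Q e' := by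
  rw [step_of_some p S ω t h] at hnew ⊢
  intro e' he'
  simp only [List.mem_append, List.mem_filter, decide_eq_true_eq,
    mem_newEntries p S ω (childLeft_ne_zero t), mem_newEntries p S ω (childRight_ne_zero t)] at he'
  rcases he' with (⟨h1, h2⟩ | ⟨h1, rfl⟩) | ⟨h1, rfl⟩
  · exact hold e' h1 h2
  · exact hnew _ (Or.inl rfl) h1
  · exact hnew _ (Or.inr rfl) h1

lemma leafData_step {t : Fin p.M} {s : State H p} {e : Entry H p}
    (h : s.queue.argmax Entry.priority = some e) {ℓ : Node p} (h1 : ℓ ≠ e.leaf)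
    (h2 : ℓ.1 ≤ 2 * t) :
    leafData S (step p S PS ω t s).tree ℓ = leafData S s.tree ℓ := by
  rw [step_of_some p S ω t h]
  refine leafData_split_of_ne S _ _ h1 ?_ ?_ <;>
    simp only [childLeft, childRight, ne_eq, Fin.ext_iff] <;> omega

lemma State.Coherent.step {t : Fin p.M} {s : State H p} (hs : s.Coherent p S PS ω t) :
    (step p S PS ω t s).Coherent p S PS ω (t + 1) := by
  cases h : s.queue.argmax Entry.priority with
  | none =>
    rw [step_of_none p S ω t h]
    exact ⟨fun x => (hs.eval_le x).trans (by omega), fun e he => (hs.leaf_le e he).trans (by omega),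
      fun e he => (hs.depth_le e he).trans (by omega), hs.depth_pos,
      hs.split_eq, hs.priority_eq, hs.weight_le⟩
  | some e =>
    have he := List.argmax_mem h
    have hd := hs.depth_le e he
    have hne : ∀ ℓ, ℓ = childLeft t ∨ ℓ = childRight t → ℓ ≠ 0 := by
      rintro ℓ (rfl | rfl)
      exacts [childLeft_ne_zero t, childRight_ne_zero t]
    refine ⟨?_, forall_mem_step_queue h ?_ ?_, forall_mem_step_queue h ?_ ?_,
      forall_mem_step_queue h ?_ ?_, forall_mem_step_queue h ?_ ?_, forall_mem_step_queue h ?_ ?_,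
      forall_mem_step_queue h ?_ ?_⟩
    · intro x
      rw [step_of_some p S ω t h]
      simp only [DTree.eval_split]
      have := hs.eval_le x
      split_ifs
      · simp only [childRight]; omega
      · simp only [childLeft]; omega
      · omega
    · exact fun e' he' _ => (hs.leaf_le e' he').trans (by omega)
    · rintro ℓ (rfl | rfl) -
      · simp only [childLeft]; omega
      · simp only [childRight]; omega
    · exact fun e' he' _ => (hs.depth_le e' he').trans (by omega)
    · intro ℓ _ _; simp only; omega
    · exact fun e' he' _ => hs.depth_pos e' he'
    · intro ℓ _ _ _; simp only; omega
    · intro e' he' h1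
      rw [leafData_step h h1 (hs.leaf_le e' he')]; exact hs.split_eq e' he'
    · intro ℓ _ _; rfl
    · intro e' he' h1
      rw [leafData_step h h1 (hs.leaf_le e' he')]; exact hs.priority_eq e' he'
    · intro ℓ _ _; rfl
    · intro e' he' h1
      rw [leafData_step h h1 (hs.leaf_le e' he')]; exact hs.weight_le e' he'
    · intro ℓ _ hw _; exact hw

variable (p S PS ω)

lemma coherent_stateAfter (t : ℕ) (ht : t ≤ p.M) :
    (stateAfter p S PS ω t ht).Coherent p S PS ω t := by
  induction t with
  | zero => exact coherent_initState p S PS ω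
  | succ t ih => exact State.Coherent.step (t := ⟨t, ht⟩) (ih _)

end Calls

/-! ### The combinatorial part of a state -/

section Skeleton

variable {X : Type*} {H : Set (X → Bool)} {k : ℕ} {Ω : Type*} (p : Params)
  (S : Dataset X k) (PS : SplitMechanism H k Ω)

/-- The points that occur in a data set. -/
abbrev Dataset.Point (S : Dataset X k) := {x : X // x ∈ S.total}

instance finite_point : Finite S.Point := Multiset.finite_toSet S.total

/-- The assignment of the data points to the leaves, and the queue with only the names and depths
of its leaves. -/
abbrev Skeleton := (S.Point → Node p) × List (Node p × ℕ)

/-- The state without splitting functions and priorities. -/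
def State.skeleton (s : State H p) : Skeleton p S :=
  (fun x => s.tree.eval x.1, s.queue.map fun e => (e.leaf, e.depth))

variable {p S}

open Classical in
/-- The data assigned to a leaf. -/
noncomputable def partData (r : S.Point → Node p) (ℓ : Node p) : Dataset X k :=
  fun i => (S i).filter fun x => ∃ hx : x ∈ S.total, r ⟨x, hx⟩ = ℓ

lemma partData_eval (T : DTree H (Node p)) (ℓ : Node p) :
    partData (S := S) (fun x => T.eval x.1) ℓ = leafData S T ℓ := by
  classical
  funext i
  refine Multiset.filter_congr fun x hx => ?_
  simp [Dataset.mem_total_of_mem hx]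

variable (ω : Node p → Seed k Ω)

/-- The assignment of the data points after splitting the leaf `ℓ` by `h`. -/
noncomputable def splitAssignment (t : Fin p.M) (r : S.Point → Node p) (ℓ : Node p)
    (h : S.Point → Bool) : S.Point → Node p :=
  fun x => if r x = ℓ then (if h x = true then childRight t else childLeft t) else r x

/-- The queue element with the largest priority. -/
noncomputable def Skeleton.top (c : Skeleton p S) : Option (Node p × ℕ) :=
  c.2.argmax fun q => nodePriority p S PS (partData c.1 q.1) q.1 q.2 (ω q.1)

/-- The leaf to be split next, the assignment of the data points after the split, and the depth
of the new leaves. -/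
noncomputable def Skeleton.next (t : Fin p.M) (c : Skeleton p S) :
    Option (Node p × (S.Point → Node p) × ℕ) :=
  (c.top PS ω).map fun q => (q.1, splitAssignment t c.1 q.1
    (fun x => (nodeCall p PS (partData c.1 q.1) q.1 q.2 (ω q.1)).1.1 x.1), q.2 + 1)

/-- The elements put into the queue for a new leaf. -/
noncomputable def Skeleton.push (r : S.Point → Node p) (ℓ : Node p) (d : ℕ) :
    List (Node p × ℕ) :=
  if p.ε / p.M ≤ nodeWeight p S (partData r ℓ) ℓ d (ω ℓ) then [(ℓ, d)] else []

/-- One iteration of the main loop, on the level of skeletons. -/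
noncomputable def Skeleton.step (t : Fin p.M) (c : Skeleton p S) : Skeleton p S :=
  (c.next PS ω t).elim c fun q => (q.2.1, c.2.filter (fun e => e.1 ≠ q.1)
    ++ push ω q.2.1 (childLeft t) q.2.2 ++ push ω q.2.1 (childRight t) q.2.2)

variable {PS ω}

/-- By coherence a priority is determined by the name, depth and data of its leaf together with the
seed there, so the skeleton already decides which leaf is popped. -/
lemma State.Coherent.top_skeleton {t : ℕ} {s : State H p} (hs : s.Coherent p S PS ω t) :
    (s.skeleton p S).top PS ω
      = (s.queue.argmax Entry.priority).map fun e => (e.leaf, e.depth) := by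
  refine argmax_map_of_eq _ _ fun e he => ?_
  rw [hs.priority_eq e he]
  simp only [State.skeleton, partData_eval]

lemma State.Coherent.next_skeleton {t : Fin p.M} {s : State H p} (hs : s.Coherent p S PS ω t) :
    (s.skeleton p S).next PS ω t
      = (s.queue.argmax Entry.priority).map fun e => (e.leaf,
        fun x : S.Point => (DPTopDown.step p S PS ω t s).tree.eval x.1, e.depth + 1) := by
  rw [Skeleton.next, hs.top_skeleton, Option.map_map]
  cases h : s.queue.argmax Entry.priority with
  | none => rfl
  | some e =>
    have he := List.argmax_mem h
    simp only [Option.map_some, Function.comp, State.skeleton, partData_eval,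
      step_of_some p S ω t h, DTree.eval_split, hs.split_eq e he]
    rfl

/-- Skeletons evolve autonomously given the seeds; measurability of a run can thus be proved in a
countable type, without any sigma-algebra on trees. -/
lemma State.Coherent.step_skeleton {t : Fin p.M} {s : State H p} (hs : s.Coherent p S PS ω t) :
    (DPTopDown.step p S PS ω t s).skeleton p S = (s.skeleton p S).step PS ω t := by
  rw [Skeleton.step, hs.next_skeleton]
  cases h : s.queue.argmax Entry.priority with
  | none => rw [step_of_none p S ω t h]; rfl
  | some e =>
    have hpush : ∀ ℓ : Node p, ℓ ≠ 0 → ∀ (T : DTree H (Node p)) (d : ℕ),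
        (newEntries p S PS ω T ℓ d).map (fun e => (e.leaf, e.depth))
          = Skeleton.push (S := S) ω (fun x => T.eval x.1) ℓ d := by
      intro ℓ hℓ T d
      simp only [Skeleton.push, partData_eval, nodeWeight, if_neg hℓ, newEntries]
      split_ifs <;> rfl
    simp only [Option.map_some, Option.elim_some]
    rw [← hpush _ (childLeft_ne_zero t), ← hpush _ (childRight_ne_zero t)]
    simp only [step_of_some p S ω t h, State.skeleton, List.map_append, List.filter_map]
    rfl

section Measurability

variable [MeasurableSpace Ω]

lemma measurable_nodeCall (hPS : ∀ D a δ, Measurable (PS D a δ))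
    (D : Dataset X k) (ℓ : Node p) (d : ℕ) :
    Measurable (nodeCall p PS D ℓ d) :=
  (hPS _ _ _).comp measurable_fst

lemma measurable_nodeWeight (D : Dataset X k) (ℓ : Node p) (d : ℕ) :
    Measurable (nodeWeight (Ω := Ω) p S D ℓ d) := by
  unfold nodeWeight weightEstimate
  by_cases h : ℓ = 0
  · simp only [h, if_true]; exact measurable_const
  · simp only [h, if_false]
    refine Measurable.div_const (Finset.measurable_sum _ fun i _ => ?_) _
    exact (((measurable_pi_apply i).comp
      (measurable_fst.comp measurable_snd)).const_mul _).const_add _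

lemma measurable_nodePriority (hPS : ∀ D a δ, Measurable (PS D a δ))
    (D : Dataset X k) (ℓ : Node p) (d : ℕ) :
    Measurable (nodePriority p S PS D ℓ d) :=
  (measurable_nodeWeight D ℓ d).mul (measurable_snd.comp (measurable_nodeCall hPS D ℓ d))

/-- A split matters only through its values at the finitely many data points, and evaluations
generate the sigma-algebra of H. -/
lemma fiberMeasurable_next (hPS : ∀ D a δ, Measurable (PS D a δ))
    (t : Fin p.M) (c : Skeleton p S) :
    FiberMeasurable fun ω : Node p → Seed k Ω => c.next PS ω t := by
  have htop : FiberMeasurable fun ω : Node p → Seed k Ω => c.top PS ω :=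
    FiberMeasurable.argmax _ fun q =>
      (measurable_nodePriority hPS _ _ _).comp (measurable_pi_apply q.1)
  refine htop.bind (F := fun o ω => o.map fun q => (q.1, splitAssignment t c.1 q.1
    (fun x => (nodeCall p PS (partData c.1 q.1) q.1 q.2 (ω q.1)).1.1 x.1), q.2 + 1)) ?_
  rintro (_ | q)
  · exact FiberMeasurable.const none
  · have hh : FiberMeasurable fun (ω : Node p → Seed k Ω) (x : S.Point) =>
        (nodeCall p PS (partData c.1 q.1) q.1 q.2 (ω q.1)).1.1 x.1 := by
      intro s
      have : {ω : Node p → Seed k Ω | (fun x : S.Point =>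
          (nodeCall p PS (partData c.1 q.1) q.1 q.2 (ω q.1)).1.1 x.1) = s}
          = ⋂ x : S.Point,
            {ω | (nodeCall p PS (partData c.1 q.1) q.1 q.2 (ω q.1)).1.1 x.1 = s x} := by
        ext ω; simp [funext_iff]
      rw [this]
      refine MeasurableSet.iInter fun x => ?_
      have hm : Measurable fun ω : Node p → Seed k Ω =>
          (nodeCall p PS (partData c.1 q.1) q.1 q.2 (ω q.1)).1.1 x.1 :=
        (measurable_pi_apply x.1).comp (measurable_subtype_coe.comp (measurable_fst.comp
          ((measurable_nodeCall hPS _ _ _).comp (measurable_pi_apply q.1))))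
      exact hm (measurableSet_singleton (s x))
    exact hh.map fun s => some (q.1, splitAssignment t c.1 q.1 s, q.2 + 1)

lemma fiberMeasurable_push (r : S.Point → Node p) (ℓ : Node p) (d : ℕ) :
    FiberMeasurable fun ω : Node p → Seed k Ω => Skeleton.push ω r ℓ d :=
  FiberMeasurable.ite (measurableSet_le measurable_const
    ((measurable_nodeWeight _ _ _).comp (measurable_pi_apply ℓ))) _ _

lemma fiberMeasurable_step (hPS : ∀ D a δ, Measurable (PS D a δ))
    (t : Fin p.M) (c : Skeleton p S) :
    FiberMeasurable fun ω : Node p → Seed k Ω => c.step PS ω t := by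
  refine (fiberMeasurable_next hPS t c).bind (F := fun o ω => o.elim c fun q =>
    (q.2.1, c.2.filter (fun e => e.1 ≠ q.1) ++ Skeleton.push ω q.2.1 (childLeft t) q.2.2
      ++ Skeleton.push ω q.2.1 (childRight t) q.2.2)) ?_
  rintro (_ | q)
  · exact FiberMeasurable.const c
  · refine (fiberMeasurable_push q.2.1 (childLeft t) q.2.2).bind (F := fun l ω =>
      (q.2.1, c.2.filter (fun e => e.1 ≠ q.1) ++ l
        ++ Skeleton.push ω q.2.1 (childRight t) q.2.2)) fun l => ?_
    exact (fiberMeasurable_push q.2.1 (childRight t) q.2.2).map fun l' =>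
      (q.2.1, c.2.filter (fun e => e.1 ≠ q.1) ++ l ++ l')

lemma fiberMeasurable_skeleton (hPS : ∀ D a δ, Measurable (PS D a δ))
    (t : ℕ) (ht : t ≤ p.M) :
    FiberMeasurable fun ω : Node p → Seed k Ω => (stateAfter p S PS ω t ht).skeleton p S := by
  induction t with
  | zero => exact FiberMeasurable.const (fun _ => 0, [(0, 0)])
  | succ t ih =>
    have h : ∀ ω : Node p → Seed k Ω, (stateAfter p S PS ω (t + 1) ht).skeleton p S
        = ((stateAfter p S PS ω t (Nat.le_of_succ_le ht)).skeleton p S).step PS ω ⟨t, ht⟩ :=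
      fun ω => State.Coherent.step_skeleton (t := ⟨t, ht⟩) (coherent_stateAfter p S PS ω t _)
    simp only [h]
    exact (ih _).bind fun c => fiberMeasurable_step hPS ⟨t, ht⟩ c

end Measurability

end Skeleton

/-! ### Good runs have high probability -/

section GoodRuns

variable {X : Type*} (f : X → Bool) {H : Set (X → Bool)} {k : ℕ} {Ω : Type*} (p : Params)
  (S : Dataset X k) (PS : SplitMechanism H k Ω)

/-- The call of `PrivateSplit` at a node returned a `ζ`-optimal split and its gain up to `ζ`. -/
def GoodCall (ζ : ℝ) (D : Dataset X k) (ℓ : Node p) (d : ℕ) (z : Seed k Ω) : Prop :=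
  (∀ h : H, gain f D.total h - ζ ≤ gain f D.total (nodeCall p PS D ℓ d z).1) ∧
    |gain f D.total (nodeCall p PS D ℓ d z).1 - (nodeCall p PS D ℓ d z).2| ≤ ζ

/-- All Laplace variables of a run are at most `c`, and all calls of `PrivateSplit` on at least
`N₀` points succeed. -/
structure GoodRun (ζ N₀ c : ℝ) (ω : Node p → Seed k Ω) : Prop where
  quiet : ∀ ℓ, ω ℓ ∈ quietSeeds k Ω c
  root : N₀ ≤ S.size → GoodCall f p PS ζ S 0 0 (ω 0)
  child : ∀ (t : Fin p.M) (e : Entry H p),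
    (stateAfter p S PS ω t t.2.le).queue.argmax Entry.priority = some e →
    ∀ ℓ, ℓ = childLeft t ∨ ℓ = childRight t →
      N₀ ≤ (leafData S (step p S PS ω t (stateAfter p S PS ω t t.2.le)).tree ℓ).size →
      GoodCall f p PS ζ (leafData S (step p S PS ω t (stateAfter p S PS ω t t.2.le)).tree ℓ) ℓ
        (e.depth + 1) (ω ℓ)

lemma step_tree_congr (ω ω' : Node p → Seed k Ω) (t : Fin p.M) (s : State H p) :
    (step p S PS ω t s).tree = (step p S PS ω' t s).tree := by
  cases h : s.queue.argmax Entry.priority with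
  | none => rw [step_of_none p S ω t h, step_of_none p S ω' t h]
  | some e => rw [step_of_some p S ω t h, step_of_some p S ω' t h]

variable {p S PS}

/-- The popped leaf and the data of its children are fixed before the children's seeds are read;
those seeds only decide what enters the queue. This is the adaptivity condition for
`measure_pi_fresh_le`. -/
lemma next_skeleton_congr {ω ω' : Node p → Seed k Ω} (t : Fin p.M)
    (h : ∀ j : Node p, j.1 ≤ 2 * t → ω j = ω' j) :
    ((stateAfter p S PS ω t t.2.le).skeleton p S).next PS ω t
      = ((stateAfter p S PS ω' t t.2.le).skeleton p S).next PS ω' t := by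
  rw [(coherent_stateAfter p S PS ω t t.2.le).next_skeleton,
    (coherent_stateAfter p S PS ω' t t.2.le).next_skeleton,
    stateAfter_congr p S ω ω' t t.2.le h, step_tree_congr p S PS ω ω']

variable [MeasurableSpace Ω]

/-- The gain factors through the restriction of h to the points of A, a map into a finite discrete
space. -/
lemma measurable_gain (A : Multiset X) : Measurable fun h : H => gain f A h.1 := by
  classical
  have hfin : Finite {x : X // x ∈ A} := Multiset.finite_toSet A
  obtain ⟨F, hF⟩ : ∃ F : ({x : X // x ∈ A} → Bool) → ℝ,
      ∀ h : H, gain f A h.1 = F fun x => h.1 x.1 := by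
    refine ⟨fun s => gain f A fun x => if hx : x ∈ A then s ⟨x, hx⟩ else false, fun h => ?_⟩
    have h1 : ∀ b, A.filter (fun x => h.1 x = b)
        = A.filter fun x => (if hx : x ∈ A then h.1 x else false) = b := fun b =>
      Multiset.filter_congr fun x hx => by simp [hx]
    simp only [gain, h1]
  simp only [hF]
  have hr : Measurable fun (h : H) (x : {x : X // x ∈ A}) => h.1 x.1 :=
    measurable_pi_lambda _ fun x => (measurable_pi_apply x.1).comp measurable_subtype_coe
  have hF' : Measurable F := measurable_of_countable F
  exact hF'.comp hr

lemma measurableSet_goodCall (hPS : ∀ D a δ, Measurable (PS D a δ)) (ζ : ℝ) (D : Dataset X k)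
    (ℓ : Node p) (d : ℕ) : MeasurableSet {z | GoodCall f p PS ζ D ℓ d z} := by
  have h1 : Measurable fun z => gain f D.total (nodeCall p PS D ℓ d z).1 :=
    (measurable_gain f D.total).comp (measurable_fst.comp (measurable_nodeCall hPS D ℓ d))
  have h2 : Measurable fun z => (nodeCall p PS D ℓ d z).2 :=
    measurable_snd.comp (measurable_nodeCall hPS D ℓ d)
  refine MeasurableSet.inter ?_ (measurableSet_le (h1.sub h2).norm measurable_const)
  -- H may be uncountable, so the universal quantifier is replaced by a supremum. This needs H
  -- nonempty, which any element of the set guarantees.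
  rcases Set.eq_empty_or_nonempty {z | ∀ h : H, gain f D.total h - ζ
    ≤ gain f D.total (nodeCall p PS D ℓ d z).1} with h0 | ⟨z₀, hz₀⟩
  · change MeasurableSet {z | ∀ h : H, gain f D.total h - ζ
      ≤ gain f D.total (nodeCall p PS D ℓ d z).1}
    rw [h0]; exact MeasurableSet.empty
  · have hbdd : BddAbove (Set.range fun h : H => gain f D.total h.1) :=
      ⟨1, by rintro _ ⟨h, rfl⟩; exact gain_le_one f _ _⟩
    have hne : Nonempty H := ⟨(nodeCall p PS D ℓ d z₀).1⟩
    have : {z : Seed k Ω | ∀ h : H, gain f D.total h - ζ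
        ≤ gain f D.total (nodeCall p PS D ℓ d z).1}
        = {z | (⨆ h : H, gain f D.total h.1) ≤ gain f D.total (nodeCall p PS D ℓ d z).1 + ζ} := by
      ext z
      simp only [Set.mem_ofPred_eq, ciSup_le_iff hbdd, sub_le_iff_le_add]
    change MeasurableSet {z : Seed k Ω | ∀ h : H, gain f D.total h - ζ
        ≤ gain f D.total (nodeCall p PS D ℓ d z).1}
    rw [this]
    exact measurableSet_le measurable_const (h1.add_const ζ)

variable (P : Measure Ω) [IsProbabilityMeasure P]

/-- The seeds at the node `ℓ` for which the call on the data given by an iteration fails. -/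
def badSeeds (PS : SplitMechanism H k Ω) (ζ N₀ : ℝ) (ℓ : Node p) :
    Option (Node p × (S.Point → Node p) × ℕ) → Set (Seed k Ω)
  | none => ∅
  -- The guards on depth and size make the failure bound valid for every value, including those that
  -- no run attains.
  | some q => {z | (1 ≤ q.2.2 ∧ q.2.2 ≤ p.M ∧ N₀ ≤ (partData q.2.1 ℓ).size) ∧
      ¬ GoodCall f p PS ζ (partData q.2.1 ℓ) ℓ q.2.2 z}

lemma runMeasure_child_le (hPS : ∀ D a δ, Measurable (PS D a δ)) {ζ N₀ : ℝ} {b : ENNReal}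
    (hb : ∀ (D : Dataset X k) (ℓ : Node p) (d : ℕ), ℓ = 0 ∨ (1 ≤ d ∧ d ≤ p.M) → N₀ ≤ D.size →
      seedMeasure k P {z | ¬ GoodCall f p PS ζ D ℓ d z} ≤ b) (t : Fin p.M) (ℓ : Node p)
    (hℓ : 2 * t.1 < ℓ.1) :
    runMeasure p k P {ω | ω ℓ ∈ badSeeds f PS ζ N₀ ℓ
      (((stateAfter p S PS ω t t.2.le).skeleton p S).next PS ω t)} ≤ b := by
  refine measure_pi_fresh_le (seedMeasure k P) ℓ
    ((fiberMeasurable_skeleton hPS t t.2.le).bind fun c => fiberMeasurable_next hPS t c) ?_ ?_ ?_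
  · intro ω ω' h
    exact next_skeleton_congr t fun j hj => h j (by rintro rfl; omega)
  · rintro (_ | q)
    · exact MeasurableSet.empty
    · exact (MeasurableSet.const _).inter (measurableSet_goodCall f hPS _ _ _ _).compl
  · rintro (_ | q)
    · simp [badSeeds]
    · by_cases hq : 1 ≤ q.2.2 ∧ q.2.2 ≤ p.M ∧ N₀ ≤ (partData q.2.1 ℓ).size
      · refine (measure_mono ?_).trans (hb (partData q.2.1 ℓ) ℓ q.2.2 (Or.inr ⟨hq.1, hq.2.1⟩)
          hq.2.2)
        exact fun z hz => hz.2
      · simp [badSeeds, hq]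

lemma runMeasure_seed (ℓ : Node p) {A : Set (Seed k Ω)} (hA : MeasurableSet A) :
    runMeasure p k P {ω | ω ℓ ∈ A} = seedMeasure k P A :=
  (measurePreserving_eval (fun _ : Node p => seedMeasure k P) ℓ).measure_preimage
    hA.nullMeasurableSet

lemma measurableSet_quietSeeds (c : ℝ) : MeasurableSet (quietSeeds k Ω c) := by
  have : quietSeeds k Ω c = (⋂ i : Fin k, {z : Seed k Ω | |z.2.1 i| ≤ c}) ∩
      ⋂ (y : Bool) (i : Fin k), {z : Seed k Ω | |z.2.2 y i| ≤ c} := by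
    ext z; simp [quietSeeds]
  rw [this]
  refine (MeasurableSet.iInter fun i => ?_).inter (MeasurableSet.iInter fun y =>
    MeasurableSet.iInter fun i => ?_)
  · exact measurableSet_le ((measurable_pi_apply i).comp
      (measurable_fst.comp measurable_snd)).norm measurable_const
  · have h : Measurable fun z : Seed k Ω => z.2.2 y i := (measurable_pi_apply i).comp
      ((measurable_pi_apply y).comp (measurable_snd.comp measurable_snd))
    exact measurableSet_le h.norm measurable_const

/-- Union bound over 2M+1 nodes for the noise, and over the root call and two child calls per
iteration. The event of a good run itself is not shown to be measurable; covering its complement by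
bad events is enough. -/
lemma runMeasure_not_goodRun_le (hPS : ∀ D a δ, Measurable (PS D a δ)) {ζ N₀ c : ℝ} (hc : 0 ≤ c)
    {b : ENNReal}
    (hb : ∀ (D : Dataset X k) (ℓ : Node p) (d : ℕ), ℓ = 0 ∨ (1 ≤ d ∧ d ≤ p.M) → N₀ ≤ D.size →
      seedMeasure k P {z | ¬ GoodCall f p PS ζ D ℓ d z} ≤ b) :
    runMeasure p k P {ω | ¬ GoodRun f p S PS ζ N₀ c ω}
      ≤ (2 * p.M + 1) * (ENNReal.ofReal (3 * k * Real.exp (-c)) + b) := by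
  let rootBad : Set (Node p → Seed k Ω) := {ω | N₀ ≤ S.size ∧ ¬ GoodCall f p PS ζ S 0 0 (ω 0)}
  let childBad : Fin p.M → Node p → Set (Node p → Seed k Ω) := fun t ℓ =>
    {ω | ω ℓ ∈ badSeeds f PS ζ N₀ ℓ (((stateAfter p S PS ω t t.2.le).skeleton p S).next PS ω t)}
  have hsub : {ω | ¬ GoodRun f p S PS ζ N₀ c ω} ⊆ (⋃ ℓ, {ω | ω ℓ ∈ (quietSeeds k Ω c)ᶜ}) ∪
      (rootBad ∪ ⋃ t, (childBad t (childLeft t) ∪ childBad t (childRight t))) := by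
    intro ω hω
    by_contra hout
    simp only [Set.mem_union, Set.mem_iUnion, not_or, not_exists] at hout
    obtain ⟨h1, h2, h3⟩ := hout
    refine hω ⟨fun ℓ => by simpa using h1 ℓ, fun hN => ?_, ?_⟩
    · by_contra hbad
      exact h2 ⟨hN, hbad⟩
    · intro t e he ℓ hℓ hN
      have hco := coherent_stateAfter p S PS ω t t.2.le
      have hd := hco.depth_le e (List.argmax_mem he)
      by_contra hbad
      have hmem : ω ∈ childBad t ℓ := by
        change ω ℓ ∈ badSeeds f PS ζ N₀ ℓ _
        rw [hco.next_skeleton, he]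
        simp only [Option.map_some, badSeeds, partData_eval]
        exact ⟨⟨by omega, by have := t.2; omega, hN⟩, hbad⟩
      rcases hℓ with rfl | rfl
      exacts [(h3 t).1 hmem, (h3 t).2 hmem]
  have hroot : runMeasure p k P rootBad ≤ b := by
    by_cases hN : N₀ ≤ S.size
    · have : rootBad = {ω | ω 0 ∈ {z | ¬ GoodCall f p PS ζ S 0 0 z}} := by
        ext ω; simp [rootBad, hN]
      rw [this]
      refine (runMeasure_seed P 0 (measurableSet_goodCall f hPS _ _ _ _).compl).trans_le ?_
      exact hb S 0 0 (Or.inl rfl) hN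
    · simp [rootBad, hN]
  have hchild : ∀ t, runMeasure p k P (childBad t (childLeft t) ∪ childBad t (childRight t))
      ≤ 2 * b := fun t => by
    rw [two_mul]
    exact (measure_union_le _ _).trans (add_le_add
      (runMeasure_child_le f P hPS hb t _ (by simp [childLeft]))
      (runMeasure_child_le f P hPS hb t _ (by simp [childRight])))
  calc runMeasure p k P {ω | ¬ GoodRun f p S PS ζ N₀ c ω}
      ≤ ∑ _ℓ : Node p, ENNReal.ofReal (3 * k * Real.exp (-c)) + (b + ∑ _t : Fin p.M, 2 * b) := by
        refine (measure_mono hsub).trans ((measure_union_le _ _).trans (add_le_add ?_ ?_))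
        · refine (measure_iUnion_fintype_le _ _).trans (Finset.sum_le_sum fun ℓ _ => ?_)
          rw [runMeasure_seed P ℓ (measurableSet_quietSeeds c).compl]
          exact seedMeasure_quiet P hc
        · refine (measure_union_le _ _).trans (add_le_add hroot ?_)
          exact (measure_iUnion_fintype_le _ _).trans (Finset.sum_le_sum fun t _ => hchild t)
    _ = (2 * p.M + 1) * (ENNReal.ofReal (3 * k * Real.exp (-c)) + b) := by
        simp only [Finset.sum_const, Finset.card_univ, Fintype.card_fin, nsmul_eq_mul]
        push_cast
        ring

end GoodRuns

/-! ### Progress of a good run -/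

lemma sum_countP_fiber {X L : Type*} [Fintype L] [DecidableEq L] (A : Multiset X) (g : X → L)
    (P : X → Prop) [DecidablePred P] :
    ∑ ℓ, (A.filter fun x => g x = ℓ).countP P = A.countP P := by
  induction A using Multiset.induction_on with
  | empty => simp
  | cons a s ih =>
    rw [Multiset.countP_cons, ← ih]
    have : ∀ ℓ, ((a ::ₘ s).filter fun x => g x = ℓ).countP P
        = (s.filter fun x => g x = ℓ).countP P + if g a = ℓ then (if P a then 1 else 0) else 0 := by
      intro ℓ
      by_cases h : g a = ℓ
      · simp [h, Multiset.countP_cons]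
      · simp [h]
    simp only [this, Finset.sum_add_distrib, Finset.sum_ite_eq, Finset.mem_univ, if_true]

section Progress

variable {X : Type*} {f : X → Bool} {H : Set (X → Bool)} {k : ℕ} {Ω : Type*} {p : Params}
  {S : Dataset X k} {PS : SplitMechanism H k Ω} {ω : Node p → Seed k Ω}

/-- The sample that reaches a leaf. -/
def leafSample (S : Dataset X k) (T : DTree H (Node p)) (ℓ : Node p) : Multiset X :=
  S.total.filter fun x => T.eval x = ℓ

lemma total_leafData (T : DTree H (Node p)) (ℓ : Node p) :
    (leafData S T ℓ).total = leafSample S T ℓ :=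
  Dataset.total_restrict S _

lemma size_leafData (T : DTree H (Node p)) (ℓ : Node p) :
    (leafData S T ℓ).size = (leafSample S T ℓ).card := by
  rw [Dataset.size, total_leafData]

lemma sum_card_leafSample (T : DTree H (Node p)) :
    ∑ ℓ, ((leafSample S T ℓ).card : ℝ) = S.size := by
  have := sum_countP_fiber S.total T.eval fun _ => True
  simp only [Multiset.countP_True] at this
  exact_mod_cast this

lemma leafSample_step {t : Fin p.M} {s : State H p} {e : Entry H p}
    (h : s.queue.argmax Entry.priority = some e) {ℓ : Node p} (h1 : ℓ ≠ e.leaf)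
    (h2 : ℓ.1 ≤ 2 * t) :
    leafSample S (step p S PS ω t s).tree ℓ = leafSample S s.tree ℓ := by
  rw [← total_leafData, ← total_leafData, leafData_step h h1 h2]

lemma State.Coherent.leafSample_childLeft {t : Fin p.M} {s : State H p}
    (hs : s.Coherent p S PS ω t) {e : Entry H p} (h : s.queue.argmax Entry.priority = some e) :
    leafSample S (DPTopDown.step p S PS ω t s).tree (childLeft t)
      = (leafSample S s.tree e.leaf).filter fun x => e.split.1 x = false := by
  rw [step_of_some p S ω t h, leafSample, leafSample, Multiset.filter_filter]
  refine Multiset.filter_congr fun x _ => ?_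
  -- The new name is unused before the split, so no other data arrive at this child.
  have hx : s.tree.eval x ≠ childLeft t := fun hx => by
    have := hs.eval_le x
    rw [hx] at this
    simp only [childLeft] at this
    omega
  rw [DTree.eval_split]
  by_cases h1 : s.tree.eval x = e.leaf <;> by_cases h2 : e.split.1 x = true <;>
    simp [h1, h2, (childLeft_ne_childRight t).symm]
  all_goals exact hx

lemma State.Coherent.leafSample_childRight {t : Fin p.M} {s : State H p}
    (hs : s.Coherent p S PS ω t) {e : Entry H p} (h : s.queue.argmax Entry.priority = some e) :
    leafSample S (DPTopDown.step p S PS ω t s).tree (childRight t)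
      = (leafSample S s.tree e.leaf).filter fun x => e.split.1 x = true := by
  rw [step_of_some p S ω t h, leafSample, leafSample, Multiset.filter_filter]
  refine Multiset.filter_congr fun x _ => ?_
  have hx : s.tree.eval x ≠ childRight t := fun hx => by
    have := hs.eval_le x
    rw [hx] at this
    simp only [childRight] at this
    omega
  rw [DTree.eval_split]
  by_cases h1 : s.tree.eval x = e.leaf <;> by_cases h2 : e.split.1 x = true <;>
    simp [h1, h2, childLeft_ne_childRight t]
  all_goals exact hx

/-- The leaves in the queue. -/
def State.active (s : State H p) : Finset (Node p) := (s.queue.map Entry.leaf).toFinset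

lemma State.mem_active {s : State H p} {ℓ : Node p} :
    ℓ ∈ s.active ↔ ∃ e ∈ s.queue, e.leaf = ℓ := by
  simp [State.active]

/-- Only an inclusion, because children of small estimated weight are not queued. -/
lemma active_step_subset {t : Fin p.M} {s : State H p} {e : Entry H p}
    (h : s.queue.argmax Entry.priority = some e) :
    (step p S PS ω t s).active ⊆
      insert (childLeft t) (insert (childRight t) (s.active.erase e.leaf)) := by
  intro ℓ hℓ
  obtain ⟨e', he', rfl⟩ := State.mem_active.1 hℓ
  refine forall_mem_step_queue h (Q := fun e' => e'.leaf ∈ insert (childLeft t)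
    (insert (childRight t) (s.active.erase e.leaf))) ?_ ?_ e' he'
  · intro e'' h1 h2
    simp [h2, State.mem_active.2 ⟨e'', h1, rfl⟩]
  · rintro ℓ (rfl | rfl) - <;> simp

lemma active_step_of_ne {t : Fin p.M} {s : State H p} {e : Entry H p}
    (h : s.queue.argmax Entry.priority = some e) {ℓ : Node p} (hℓ : ℓ ∈ s.active)
    (hne : ℓ ≠ e.leaf) : ℓ ∈ (step p S PS ω t s).active := by
  obtain ⟨e', he', rfl⟩ := State.mem_active.1 hℓ
  refine State.mem_active.2 ⟨e', ?_, rfl⟩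
  rw [step_of_some p S ω t h]
  simp [he', hne]

/-- The total entropy of the leaves in the queue. -/
noncomputable def State.potential (f : X → Bool) (S : Dataset X k) (s : State H p) : ℝ :=
  ∑ ℓ ∈ s.active, sampleEntropy f (leafSample S s.tree ℓ)

/-- The popped leaf is exchanged for at most its two children and all other active samples stay the
same; a child left out of the queue only lowers the sum further. -/
lemma State.Coherent.potential_step {t : Fin p.M} {s : State H p}
    (hs : s.Coherent p S PS ω t) {e : Entry H p} (h : s.queue.argmax Entry.priority = some e) :
    (DPTopDown.step p S PS ω t s).potential f S ≤ s.potential f S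
      - (leafSample S s.tree e.leaf).card * gain f (leafSample S s.tree e.leaf) e.split
        * Real.log 2 := by
  have he : e.leaf ∈ s.active := State.mem_active.2 ⟨e, List.argmax_mem h, rfl⟩
  have hlt : ∀ ℓ ∈ s.active, ℓ.1 ≤ 2 * t := by
    intro ℓ hℓ
    obtain ⟨e', he', rfl⟩ := State.mem_active.1 hℓ
    exact hs.leaf_le e' he'
  have hl : childLeft t ∉ insert (childRight t) (s.active.erase e.leaf) := by
    simp only [Finset.mem_insert, Finset.mem_erase, not_or, not_and]
    refine ⟨childLeft_ne_childRight t, fun _ hmem => ?_⟩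
    have := hlt _ hmem
    simp only [childLeft] at this
    omega
  have hr : childRight t ∉ s.active.erase e.leaf := by
    simp only [Finset.mem_erase, not_and]
    intro _ hmem
    have := hlt _ hmem
    simp only [childRight] at this
    omega
  rw [card_mul_gain, ← hs.leafSample_childLeft h, ← hs.leafSample_childRight h]
  have h1 : (DPTopDown.step p S PS ω t s).potential f S
      ≤ ∑ ℓ ∈ insert (childLeft t) (insert (childRight t) (s.active.erase e.leaf)),
        sampleEntropy f (leafSample S (DPTopDown.step p S PS ω t s).tree ℓ) :=
    Finset.sum_le_sum_of_subset_of_nonneg (active_step_subset h)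
      fun _ _ _ => sampleEntropy_nonneg f _
  rw [Finset.sum_insert hl, Finset.sum_insert hr] at h1
  have h2 : ∑ ℓ ∈ s.active.erase e.leaf,
      sampleEntropy f (leafSample S (DPTopDown.step p S PS ω t s).tree ℓ)
      = ∑ ℓ ∈ s.active.erase e.leaf, sampleEntropy f (leafSample S s.tree ℓ) := by
    refine Finset.sum_congr rfl fun ℓ hℓ => ?_
    rw [Finset.mem_erase] at hℓ
    rw [leafSample_step h hℓ.1 (hlt ℓ hℓ.2)]
  have h3 := Finset.add_sum_erase s.active
    (fun ℓ => sampleEntropy f (leafSample S s.tree ℓ)) he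
  have h4 : s.potential f S = _ := h3.symm
  linarith

/-- Bound each entropy by its minority times log(1/m) plus 2m times the leaf size. The size terms
add up to at most half of the potential, and averaging the rest over at most c leaves gives one with
a large minority. -/
lemma exists_minority_ge {s : State H p} {m : ℝ} (hm : 0 < m) (hm' : m ≤ 1 / 2) {c : ℕ}
    (hc : s.active.card ≤ c) (hpot : 4 * m * S.size ≤ s.potential f S)
    (hpos : 0 < s.potential f S) :
    ∃ e ∈ s.queue, s.potential f S / (2 * Real.log (1 / m) * c)
      ≤ minority f (leafSample S s.tree e.leaf) := by
  have hlog : 0 < Real.log (1 / m) := Real.log_pos (by rw [lt_div_iff₀ hm]; linarith)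
  have h1 : s.potential f S ≤ (∑ ℓ ∈ s.active, minority f (leafSample S s.tree ℓ))
      * Real.log (1 / m) + 2 * m * S.size := by
    calc s.potential f S ≤ ∑ ℓ ∈ s.active, (minority f (leafSample S s.tree ℓ) * Real.log (1 / m)
          + 2 * m * (leafSample S s.tree ℓ).card) :=
          Finset.sum_le_sum fun ℓ _ => sampleEntropy_le f _ hm hm'
      _ = (∑ ℓ ∈ s.active, minority f (leafSample S s.tree ℓ)) * Real.log (1 / m)
          + 2 * m * ∑ ℓ ∈ s.active, ((leafSample S s.tree ℓ).card : ℝ) := by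
          rw [Finset.sum_add_distrib, Finset.sum_mul, Finset.mul_sum]
      _ ≤ _ := by
          rw [← sum_card_leafSample (S := S) s.tree]
          gcongr
          exact Finset.subset_univ _
  have h2 : s.potential f S / (2 * Real.log (1 / m))
      ≤ ∑ ℓ ∈ s.active, minority f (leafSample S s.tree ℓ) := by
    rw [div_le_iff₀ (by positivity)]; linarith
  by_contra hcon
  push Not at hcon
  have hne : s.active.Nonempty := by
    rw [Finset.nonempty_iff_ne_empty]
    intro h0
    simp [State.potential, h0] at hpos
  have hc0 : 0 < (c : ℝ) := by exact_mod_cast (Finset.card_pos.2 hne).trans_le hc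
  have h3 : ∑ ℓ ∈ s.active, minority f (leafSample S s.tree ℓ)
      < ∑ _ℓ ∈ s.active, s.potential f S / (2 * Real.log (1 / m) * c) :=
    Finset.sum_lt_sum_of_nonempty hne fun ℓ hℓ => by
      obtain ⟨e, he, rfl⟩ := State.mem_active.1 hℓ
      exact hcon e he
  rw [Finset.sum_const, nsmul_eq_mul] at h3
  have h4 : (s.active.card : ℝ) * (s.potential f S / (2 * Real.log (1 / m) * c))
      ≤ c * (s.potential f S / (2 * Real.log (1 / m) * c)) := by
    gcongr
  have h5 : (c : ℝ) * (s.potential f S / (2 * Real.log (1 / m) * c))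
      = s.potential f S / (2 * Real.log (1 / m)) := by field_simp
  linarith

/-! ### Queue elements of a good run -/

/-- The weight estimate of a node is correct up to `η` and its split is `ζ`-optimal. -/
def GoodNode (f : X → Bool) (p : Params) (S : Dataset X k) (PS : SplitMechanism H k Ω) (ζ η : ℝ)
    (D : Dataset X k) (ℓ : Node p) (d : ℕ) (z : Seed k Ω) : Prop :=
  |nodeWeight p S D ℓ d z - D.size / S.size| ≤ η ∧ GoodCall f p PS ζ D ℓ d z

/-- A queued child has estimated weight at least ε/M, hence true weight at least ε/M - η and at
least N₀ points. So every call whose result enters the queue is covered by the utility guarantee. -/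
lemma GoodRun.goodNode {ζ N₀ c η : ℝ} (hω : GoodRun f p S PS ζ N₀ c ω) (hS : 0 < (S.size : ℝ))
    (hη : 0 ≤ η) (hnoise : ∀ (D : Dataset X k) (ℓ : Node p) (d : ℕ), ∀ z ∈ quietSeeds k Ω c,
      ℓ ≠ 0 → 1 ≤ d → d ≤ p.M → |nodeWeight p S D ℓ d z - D.size / S.size| ≤ η)
    (hN : N₀ ≤ S.size) (hN' : N₀ ≤ (p.ε / p.M - η) * S.size) (t : ℕ) (ht : t ≤ p.M) :
    ∀ e ∈ (stateAfter p S PS ω t ht).queue, GoodNode f p S PS ζ η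
      (leafData S (stateAfter p S PS ω t ht).tree e.leaf) e.leaf e.depth (ω e.leaf) := by
  induction t with
  | zero =>
    have := hω.root hN
    simp [stateAfter, initState, leafData_leaf, GoodNode, nodeWeight, this, div_self hS.ne', hη]
  | succ t ih =>
    have ih := ih (Nat.le_of_succ_le ht)
    have hco := coherent_stateAfter p S PS ω t (Nat.le_of_succ_le ht)
    rw [stateAfter]
    cases h : (stateAfter p S PS ω t (Nat.le_of_succ_le ht)).queue.argmax Entry.priority with
    | none => rw [step_of_none p S ω ⟨t, ht⟩ h]; exact ih
    | some e =>
      have hd := hco.depth_le e (List.argmax_mem h)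
      refine forall_mem_step_queue (t := ⟨t, ht⟩) h ?_ ?_
      · intro e' he' hne
        rw [leafData_step (t := ⟨t, ht⟩) h hne (hco.leaf_le e' he')]
        exact ih e' he'
      · intro ℓ hℓ hw
        have hℓ0 : ℓ ≠ 0 := by
          rcases hℓ with rfl | rfl
          exacts [childLeft_ne_zero _, childRight_ne_zero _]
        have hn := hnoise (leafData S (step p S PS ω ⟨t, ht⟩ (stateAfter p S PS ω t
          (Nat.le_of_succ_le ht))).tree ℓ) ℓ (e.depth + 1) (ω ℓ) (hω.quiet ℓ) hℓ0 (by omega)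
          (by omega)
        refine ⟨hn, hω.child ⟨t, ht⟩ e h ℓ hℓ ?_⟩
        have h1 := (abs_le.1 hn).2
        have h2 : p.ε / p.M - η ≤ (leafData S (step p S PS ω ⟨t, ht⟩ (stateAfter p S PS ω t
          (Nat.le_of_succ_le ht))).tree ℓ).size / S.size := by linarith
        rw [le_div_iff₀ hS] at h2
        exact hN'.trans h2

/-- The weight error η is multiplied by an estimated gain of size at most 2, and the gain error, at
most η, by a weight of at most 1. -/
lemma GoodNode.abs_priority_sub_le {ζ η : ℝ} {D : Dataset X k} {ℓ : Node p} {d : ℕ} {z : Seed k Ω}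
    (h : GoodNode f p S PS ζ η D ℓ d z) (hS : 0 < (S.size : ℝ)) (hζ : ζ ≤ η) (hη : η ≤ 1)
    (hD : D.size ≤ S.size) :
    |nodePriority p S PS D ℓ d z
      - D.size / S.size * gain f D.total (nodeCall p PS D ℓ d z).1| ≤ 3 * η := by
  obtain ⟨h1, -, h3⟩ := h
  have hg0 := gain_nonneg f D.total (nodeCall p PS D ℓ d z).1
  have hg1 := gain_le_one f D.total (nodeCall p PS D ℓ d z).1
  have hw0 : (0 : ℝ) ≤ D.size / S.size := by positivity
  have hw1 : (D.size : ℝ) / S.size ≤ 1 := div_le_one_of_le₀ (by exact_mod_cast hD) hS.le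
  rw [nodePriority]
  generalize nodeWeight p S D ℓ d z = w at *
  generalize (nodeCall p PS D ℓ d z).2 = J at *
  generalize gain f D.total (nodeCall p PS D ℓ d z).1 = g at *
  generalize (D.size : ℝ) / S.size = v at *
  have hη0 : 0 ≤ η := (abs_nonneg _).trans h1
  have hJ : |J| ≤ 2 := by
    rw [abs_le] at h3 ⊢; constructor <;> linarith
  have e : w * J - v * g = (w - v) * J - v * (g - J) := by ring
  rw [e]
  calc |(w - v) * J - v * (g - J)| ≤ |(w - v) * J| + |v * (g - J)| := abs_sub _ _
    _ = |w - v| * |J| + v * |g - J| := by rw [abs_mul, abs_mul, abs_of_nonneg hw0]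
    _ ≤ η * 2 + 1 * η := by gcongr; exact h3.trans hζ
    _ = 3 * η := by ring

lemma card_leafSample_le (T : DTree H (Node p)) (ℓ : Node p) :
    (leafSample S T ℓ).card ≤ S.size :=
  Multiset.card_le_card (Multiset.filter_le _ _)

/-- The split carried out gains nearly as much as every other split of a leaf in the queue. -/
lemma State.Coherent.pop_gain {t : ℕ} {s : State H p} (hs : s.Coherent p S PS ω t) {ζ η : ℝ}
    (hgood : ∀ e ∈ s.queue,
      GoodNode f p S PS ζ η (leafData S s.tree e.leaf) e.leaf e.depth (ω e.leaf))
    (hS : 0 < (S.size : ℝ)) (hζ : ζ ≤ η) (hη : η ≤ 1) {e e' : Entry H p}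
    (h : s.queue.argmax Entry.priority = some e) (he' : e' ∈ s.queue) {g : X → Bool}
    (hg : g ∈ H) :
    (leafSample S s.tree e'.leaf).card * gain f (leafSample S s.tree e'.leaf) g * Real.log 2
      ≤ (leafSample S s.tree e.leaf).card * gain f (leafSample S s.tree e.leaf) e.split
        * Real.log 2 + 7 * η * S.size := by
  have he := List.argmax_mem h
  have hle := List.le_of_mem_argmax he' h
  have hsz : ∀ ℓ, (leafData S s.tree ℓ).size ≤ S.size := fun ℓ => by
    rw [size_leafData]; exact card_leafSample_le _ _
  have h1 := (hgood e he).abs_priority_sub_le hS hζ hη (hsz _)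
  have h2 := (hgood e' he').abs_priority_sub_le hS hζ hη (hsz _)
  have h3 := (hgood e' he').2.1 ⟨g, hg⟩
  rw [← hs.priority_eq e he, ← hs.split_eq e he, size_leafData, total_leafData] at h1
  rw [← hs.priority_eq e' he', ← hs.split_eq e' he', size_leafData, total_leafData] at h2
  rw [← hs.split_eq e' he', total_leafData] at h3
  have hη0 : 0 ≤ η := (abs_nonneg _).trans (hgood e he).1
  have hw1 : ((leafSample S s.tree e'.leaf).card : ℝ) / S.size ≤ 1 :=
    div_le_one_of_le₀ (by exact_mod_cast card_leafSample_le _ _) hS.le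
  have hw0 : (0 : ℝ) ≤ ((leafSample S s.tree e'.leaf).card : ℝ) / S.size := by positivity
  have h4 := mul_le_mul_of_nonneg_left h3 hw0
  have h5 : ((leafSample S s.tree e'.leaf).card : ℝ) / S.size * ζ ≤ η :=
    (mul_le_mul_of_nonneg_left hζ hw0).trans (mul_le_of_le_one_left hη0 hw1)
  -- The 7 is 3 + 3 for the two priorities compared, plus 1 for the suboptimality of the split
  -- stored at e'.
  have h6 : ((leafSample S s.tree e'.leaf).card : ℝ) / S.size
        * gain f (leafSample S s.tree e'.leaf) g
      ≤ ((leafSample S s.tree e.leaf).card : ℝ) / S.size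
        * gain f (leafSample S s.tree e.leaf) e.split + 7 * η := by
    rw [mul_sub] at h4
    linarith [(abs_le.1 h1).2, (abs_le.1 h2).1]
  have h7 := mul_le_mul_of_nonneg_left h6 hS.le
  have e1 : (S.size : ℝ) * (((leafSample S s.tree e'.leaf).card : ℝ) / S.size
      * gain f (leafSample S s.tree e'.leaf) g)
      = (leafSample S s.tree e'.leaf).card * gain f (leafSample S s.tree e'.leaf) g := by
    field_simp
  have e2 : (S.size : ℝ) * (((leafSample S s.tree e.leaf).card : ℝ) / S.size
      * gain f (leafSample S s.tree e.leaf) e.split + 7 * η)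
      = (leafSample S s.tree e.leaf).card * gain f (leafSample S s.tree e.leaf) e.split
        + 7 * η * S.size := by
    field_simp
  rw [e1, e2] at h7
  have hl0 : 0 ≤ Real.log 2 := Real.log_nonneg one_le_two
  have hl1 : Real.log 2 ≤ 1 := by linarith [Real.log_two_lt_d9]
  have h8 := mul_le_mul_of_nonneg_right h7 hl0
  have h9 : 7 * η * S.size * Real.log 2 ≤ 7 * η * S.size :=
    mul_le_of_le_one_right (by positivity) hl1
  linarith

end Progress

/-! ### Decay of the potential along a good run -/

section Progress

variable {X : Type*} {f : X → Bool} {H : Set (X → Bool)} {k : ℕ} {Ω : Type*} {p : Params}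
  {S : Dataset X k} {PS : SplitMechanism H k Ω} {ω : Node p → Seed k Ω}

/-- One iteration decreases the potential by the factor `1 - ρ / (t + 1)`, in terms of the bounds
for the gain of the best split and for the estimation errors. -/
lemma drop_estimate {γ ε L a M η τ : ℝ} (hγ : 0 < γ) (hε : 0 < ε) (hL : 0 < L)
    (hτ : 0 < τ) (hτM : τ ≤ M) (ha : ε / 4 ≤ a)
    (hη : η = γ ^ 2 * ε / (112 * (M * L))) {L' : ℝ} (hL'0 : 0 < L') (hL' : L' ≤ 4 * L) :
    γ ^ 2 / (4 * L) / τ * a ≤ 4 * γ ^ 2 * (a / (2 * L' * τ)) - 7 * η := by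
  have ha0 : 0 < a := by linarith
  have h1 : γ ^ 2 / (2 * L) / τ * a ≤ 4 * γ ^ 2 * (a / (2 * L' * τ)) := by
    have e1 : γ ^ 2 / (2 * L) / τ * a = γ ^ 2 * a / τ * (1 / (2 * L)) := by field_simp
    have e2 : 4 * γ ^ 2 * (a / (2 * L' * τ)) = γ ^ 2 * a / τ * (2 / L') := by field_simp; ring
    rw [e1, e2]
    refine mul_le_mul_of_nonneg_left ?_ (by positivity)
    rw [div_le_div_iff₀ (by positivity) hL'0]; linarith
  -- The constant 112 = 7 · 16 in η is chosen so that the estimation error eats at most half of the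
  -- gain in the worst case a = ε/4, τ = M.
  have h2 : 7 * η ≤ γ ^ 2 / (4 * L) / τ * a := by
    have hM : 0 < M := hτ.trans_le hτM
    have e1 : 7 * η = γ ^ 2 / (4 * L) * (ε / 4 * (1 / M)) := by rw [hη]; field_simp; norm_num
    have e2 : γ ^ 2 / (4 * L) / τ * a = γ ^ 2 / (4 * L) * (a * (1 / τ)) := by field_simp
    rw [e1, e2]
    gcongr
  have e3 : γ ^ 2 / (2 * L) / τ * a = γ ^ 2 / (4 * L) / τ * a + γ ^ 2 / (4 * L) / τ * a := by
    field_simp; norm_num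
  linarith

/-- Compares the product of the factors 1 - ρ/τ with the power law τ^(-ρ), through 1 - u ≤ exp(-u)
and log(τ+1) - log τ ≤ 1/τ. -/
lemma one_sub_div_mul_exp_le {ρ τ a : ℝ} (hρ : 0 ≤ ρ) (hτ : 0 < τ)
    (ha : a ≤ Real.exp (-(ρ * Real.log τ))) (ha0 : 0 ≤ a) :
    a - ρ / τ * a ≤ Real.exp (-(ρ * Real.log (τ + 1))) := by
  have h1 : 1 - ρ / τ ≤ Real.exp (-(ρ / τ)) := by
    have := Real.add_one_le_exp (-(ρ / τ)); linarith
  have h2 : Real.log (τ + 1) - Real.log τ ≤ 1 / τ := by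
    have := Real.log_le_sub_one_of_pos (show 0 < (τ + 1) / τ by positivity)
    rw [Real.log_div (by positivity) hτ.ne'] at this
    have e : (τ + 1) / τ - 1 = 1 / τ := by field_simp; ring
    linarith
  calc a - ρ / τ * a = a * (1 - ρ / τ) := by ring
    _ ≤ a * Real.exp (-(ρ / τ)) := mul_le_mul_of_nonneg_left h1 ha0
    _ ≤ Real.exp (-(ρ * Real.log τ)) * Real.exp (-(ρ / τ)) :=
        mul_le_mul_of_nonneg_right ha (Real.exp_pos _).le
    _ = Real.exp (-(ρ * (Real.log τ + 1 / τ))) := by rw [← Real.exp_add]; congr 1; ring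
    _ ≤ Real.exp (-(ρ * Real.log (τ + 1))) := by
        refine Real.exp_le_exp.2 (neg_le_neg (mul_le_mul_of_nonneg_left ?_ hρ))
        linarith

lemma card_active_stateAfter_le (t : ℕ) (ht : t ≤ p.M) :
    (stateAfter p S PS ω t ht).active.card ≤ t + 1 := by
  induction t with
  | zero => simp [stateAfter, initState, State.active]
  | succ t ih =>
    have ih := ih (Nat.le_of_succ_le ht)
    rw [stateAfter]
    cases h : (stateAfter p S PS ω t (Nat.le_of_succ_le ht)).queue.argmax Entry.priority with
    | none => rw [step_of_none p S ω ⟨t, ht⟩ h]; omega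
    | some e =>
      have he : e.leaf ∈ (stateAfter p S PS ω t (Nat.le_of_succ_le ht)).active :=
        State.mem_active.2 ⟨e, List.argmax_mem h, rfl⟩
      have h1 := Finset.card_le_card
        (active_step_subset (p := p) (S := S) (PS := PS) (ω := ω) (t := ⟨t, ht⟩) h)
      have h2 := Finset.card_erase_add_one he
      have h3 := Finset.card_insert_le (childLeft ⟨t, ht⟩) (insert (childRight ⟨t, ht⟩)
        ((stateAfter p S PS ω t (Nat.le_of_succ_le ht)).active.erase e.leaf))
      have h4 := Finset.card_insert_le (childRight ⟨t, ht⟩)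
        ((stateAfter p S PS ω t (Nat.le_of_succ_le ht)).active.erase e.leaf)
      omega

/-- The potential never increases, so once below ε|S|/4 it stays there. Above that level a good leaf
exists and greedy popping obtains at least half of the guaranteed decrease. -/
lemma potential_stateAfter_le [MeasurableSpace X] {γ : ℝ} (hW : WeakLearning f H γ) (hγ : 0 < γ)
    {ζ η : ℝ} (hε : 0 < p.ε) (hε1 : p.ε ≤ 1) (hS : 0 < (S.size : ℝ)) (hζ : ζ ≤ η) (hη1 : η ≤ 1)
    (hη : η = γ ^ 2 * p.ε / (112 * (p.M * Real.log (2 / p.ε))))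
    (hgood : ∀ (t : ℕ) (ht : t ≤ p.M), ∀ e ∈ (stateAfter p S PS ω t ht).queue,
      GoodNode f p S PS ζ η (leafData S (stateAfter p S PS ω t ht).tree e.leaf) e.leaf e.depth
        (ω e.leaf)) (t : ℕ) (ht : t ≤ p.M) :
    (stateAfter p S PS ω t ht).potential f S ≤ S.size *
      max (p.ε / 4) (Real.exp (-(γ ^ 2 / (4 * Real.log (2 / p.ε)) * Real.log (t + 1)))) := by
  have hl2 : 0 < Real.log 2 := Real.log_pos one_lt_two
  have hLpos : Real.log 2 ≤ Real.log (2 / p.ε) := by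
    refine Real.log_le_log two_pos ?_
    rw [le_div_iff₀ hε]; linarith
  have hL : 0 < Real.log (2 / p.ε) := hl2.trans_le hLpos
  have hL' : Real.log (1 / (p.ε / 16)) ≤ 4 * Real.log (2 / p.ε) := by
    have e1 : (1 : ℝ) / (p.ε / 16) = 2 / p.ε * 2 ^ 3 := by field_simp; norm_num
    rw [e1, Real.log_mul (by positivity) (by norm_num), Real.log_pow]
    push_cast
    linarith
  have hL'0 : 0 < Real.log (1 / (p.ε / 16)) := Real.log_pos (by
    rw [lt_div_iff₀ (by positivity)]; linarith)
  induction t with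
  | zero =>
    simp only [Nat.cast_zero, zero_add, Real.log_one, mul_zero, neg_zero, Real.exp_zero]
    rw [max_eq_right (by linarith), mul_one]
    calc (stateAfter p S PS ω 0 ht).potential f S
        ≤ ∑ ℓ, ((leafSample S (stateAfter p S PS ω 0 ht).tree ℓ).card : ℝ) :=
          (Finset.sum_le_sum fun ℓ _ => sampleEntropy_le_card f _).trans
            (Finset.sum_le_sum_of_subset_of_nonneg (Finset.subset_univ _)
              fun _ _ _ => Nat.cast_nonneg _)
      _ = S.size := sum_card_leafSample _
  | succ t ih =>
    have ih := ih (Nat.le_of_succ_le ht)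
    have hco := coherent_stateAfter p S PS ω t (Nat.le_of_succ_le ht)
    have hg := hgood t (Nat.le_of_succ_le ht)
    have hcard := card_active_stateAfter_le (S := S) (PS := PS) (ω := ω) t (Nat.le_of_succ_le ht)
    rw [stateAfter]
    set s := stateAfter p S PS ω t (Nat.le_of_succ_le ht) with hs
    have hsmall : s.potential f S ≤ S.size * (p.ε / 4) → s.potential f S ≤ S.size * max (p.ε / 4)
        (Real.exp (-(γ ^ 2 / (4 * Real.log (2 / p.ε)) * Real.log (((t + 1 : ℕ) : ℝ) + 1)))) :=
      fun h => h.trans (mul_le_mul_of_nonneg_left (le_max_left _ _) hS.le)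
    cases h : s.queue.argmax Entry.priority with
    | none =>
      rw [step_of_none p S ω ⟨t, ht⟩ h]
      refine hsmall ?_
      have : s.potential f S = 0 := by
        simp [State.potential, State.active, List.argmax_eq_none.1 h]
      rw [this]; positivity
    | some e =>
      have hstep := State.Coherent.potential_step (f := f) (t := ⟨t, ht⟩) hco h
      have hdrop : 0 ≤ (leafSample S s.tree e.leaf).card *
          gain f (leafSample S s.tree e.leaf) e.split * Real.log 2 :=
        mul_nonneg (mul_nonneg (Nat.cast_nonneg _) (gain_nonneg f _ _)) hl2.le
      by_cases hpot : s.potential f S ≤ S.size * (p.ε / 4)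
      · exact (hstep.trans (sub_le_self _ hdrop)).trans (hsmall hpot)
      push Not at hpot
      have hpos : 0 < s.potential f S := lt_trans (by positivity) hpot
      -- With m = ε/16 the hypothesis on 4m|S| is exactly the current case, a potential above
      -- ε|S|/4.
      obtain ⟨e', he', hmin⟩ := exists_minority_ge (S := S) (f := f) (m := p.ε / 16)
        (by positivity) (by linarith) hcard (by linarith) hpos
      have hminpos : 0 < minority f (leafSample S s.tree e'.leaf) :=
        lt_of_lt_of_le (by positivity) hmin
      obtain ⟨g, hgH, hgain⟩ := hW.exists_split hγ _ hminpos
      rw [← card_mul_gain] at hgain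
      have hpop := hco.pop_gain hg hS hζ hη1 h he' hgH
      set a := s.potential f S / S.size with ha
      have hea : s.potential f S = S.size * a := by rw [ha]; field_simp
      have hest := drop_estimate (γ := γ) (ε := p.ε) (L := Real.log (2 / p.ε)) (a := a) (M := p.M)
        (η := η) (τ := t + 1) hγ hε hL (by positivity) (by exact_mod_cast ht)
        (by rw [ha, le_div_iff₀ hS]; linarith) hη hL'0 hL'
      have hmul := mul_le_mul_of_nonneg_left hest hS.le
      have hmin' := mul_le_mul_of_nonneg_left hmin (show 0 ≤ 4 * γ ^ 2 by positivity)
      have e2 : (S.size : ℝ) * (4 * γ ^ 2 * (a / (2 * Real.log (1 / (p.ε / 16)) * (t + 1))) - 7 * η)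
          = 4 * γ ^ 2 * (s.potential f S / (2 * Real.log (1 / (p.ε / 16)) * ((t + 1 : ℕ) : ℝ)))
            - 7 * η * S.size := by
        rw [hea]; push_cast; field_simp
      rw [e2] at hmul
      have hnew : (step p S PS ω ⟨t, ht⟩ s).potential f S ≤
          S.size * (a - γ ^ 2 / (4 * Real.log (2 / p.ε)) / (t + 1) * a) := by
        rw [mul_sub, ← hea]; linarith
      refine hnew.trans (mul_le_mul_of_nonneg_left ?_ hS.le)
      refine le_max_of_le_right ?_
      push_cast
      refine one_sub_div_mul_exp_le (by positivity) (by positivity) ?_ (by positivity)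
      have h3 : a ≤ max (p.ε / 4)
          (Real.exp (-(γ ^ 2 / (4 * Real.log (2 / p.ε)) * Real.log (t + 1)))) := by
        rw [ha, div_le_iff₀ hS]; linarith
      -- In this case the inductive bound must come from the power law and not from the floor ε/4.
      refine (le_max_iff.1 h3).resolve_left (not_le.2 ?_)
      rw [ha, lt_div_iff₀ hS]; linarith

/-! ### The leaves outside the queue -/

lemma nodeWeight_lt_of_not_active {t : Fin p.M} {s : State H p} {e : Entry H p}
    (h : s.queue.argmax Entry.priority = some e) {ℓ : Node p}
    (hℓ : ℓ = childLeft t ∨ ℓ = childRight t) (hout : ℓ ∉ (step p S PS ω t s).active) :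
    nodeWeight p S (leafData S (step p S PS ω t s).tree ℓ) ℓ (e.depth + 1) (ω ℓ) < p.ε / p.M := by
  by_contra hw
  push Not at hw
  refine hout (State.mem_active.2 ?_)
  rw [step_of_some p S ω t h] at hw ⊢
  rcases hℓ with rfl | rfl
  · exact ⟨_, List.mem_append_left _ (List.mem_append_right _
      ((mem_newEntries p S ω (childLeft_ne_zero t)).2 ⟨hw, rfl⟩)), rfl⟩
  · exact ⟨_, List.mem_append_right _
      ((mem_newEntries p S ω (childRight_ne_zero t)).2 ⟨hw, rfl⟩), rfl⟩

/-- `𝓛` contains all leaves of the tree and is small, and its leaves outside the queue are light. -/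
structure LeafCover (S : Dataset X k) (s : State H p) (θ : ℝ) (𝓛 : Finset (Node p)) : Prop where
  eval_mem : ∀ x, s.tree.eval x ∈ 𝓛
  light : ∀ ℓ ∈ 𝓛, ℓ ∉ s.active → ((leafSample S s.tree ℓ).card : ℝ) ≤ θ

/-- Each split trades one leaf for two, so t+1 names suffice. A new child outside the queue failed
the weight test, which makes its true weight less than ε/M + η. -/
lemma exists_leafCover {c η : ℝ} (hquiet : ∀ ℓ, ω ℓ ∈ quietSeeds k Ω c) (hS : 0 < (S.size : ℝ))
    (hnoise : ∀ (D : Dataset X k) (ℓ : Node p) (d : ℕ), ∀ z ∈ quietSeeds k Ω c,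
      ℓ ≠ 0 → 1 ≤ d → d ≤ p.M → |nodeWeight p S D ℓ d z - D.size / S.size| ≤ η)
    (t : ℕ) (ht : t ≤ p.M) :
    ∃ 𝓛, LeafCover S (stateAfter p S PS ω t ht) ((p.ε / p.M + η) * S.size) 𝓛 ∧
      (stateAfter p S PS ω t ht).active ⊆ 𝓛 ∧ 𝓛.card ≤ t + 1 := by
  induction t with
  | zero =>
    refine ⟨{0}, ⟨fun x => by simp [stateAfter, initState, DTree.eval], ?_⟩, ?_, by simp⟩ <;>
      simp [stateAfter, initState, State.active]
  | succ t ih =>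
    obtain ⟨𝓛, hcov, hact, hcard⟩ := ih (Nat.le_of_succ_le ht)
    have hco := coherent_stateAfter p S PS ω t (Nat.le_of_succ_le ht)
    rw [stateAfter]
    set s := stateAfter p S PS ω t (Nat.le_of_succ_le ht) with hs
    cases h : s.queue.argmax Entry.priority with
    | none => rw [step_of_none p S ω ⟨t, ht⟩ h]; exact ⟨𝓛, hcov, hact, by omega⟩
    | some e =>
      have hd := hco.depth_le e (List.argmax_mem h)
      have he : e.leaf ∈ 𝓛 := hact (State.mem_active.2 ⟨e, List.argmax_mem h, rfl⟩)
      have hchild : ∀ ℓ, ℓ = childLeft ⟨t, ht⟩ ∨ ℓ = childRight ⟨t, ht⟩ →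
          ℓ ∉ (step p S PS ω ⟨t, ht⟩ s).active →
          ((leafSample S (step p S PS ω ⟨t, ht⟩ s).tree ℓ).card : ℝ)
            ≤ (p.ε / p.M + η) * S.size := by
        intro ℓ hℓ hout
        have hℓ0 : ℓ ≠ 0 := by
          rcases hℓ with rfl | rfl
          exacts [childLeft_ne_zero _, childRight_ne_zero _]
        have h1 := nodeWeight_lt_of_not_active h hℓ hout
        have h2 := (abs_le.1 (hnoise (leafData S (step p S PS ω ⟨t, ht⟩ s).tree ℓ) ℓ (e.depth + 1)
          (ω ℓ) (hquiet ℓ) hℓ0 (by omega) (by omega))).1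
        rw [size_leafData] at h2
        rw [← div_le_iff₀ hS]
        linarith
      refine ⟨insert (childLeft ⟨t, ht⟩) (insert (childRight ⟨t, ht⟩) (𝓛.erase e.leaf)),
        ⟨fun x => ?_, fun ℓ hℓ hout => ?_⟩, ?_, ?_⟩
      · have hx := hcov.eval_mem x
        rw [step_of_some p S ω ⟨t, ht⟩ h, DTree.eval_split]
        split_ifs with h1 h2
        · simp
        · simp
        · simp [h1, hx]
      · simp only [Finset.mem_insert, Finset.mem_erase] at hℓ
        rcases hℓ with hℓ | hℓ | ⟨h1, h2⟩
        · exact hchild ℓ (Or.inl hℓ) hout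
        · exact hchild ℓ (Or.inr hℓ) hout
        · by_cases hle : ℓ.1 ≤ 2 * t
          · rw [leafSample_step (t := ⟨t, ht⟩) h h1 hle]
            exact hcov.light ℓ h2 fun hin => hout (active_step_of_ne h hin h1)
          -- The invariant does not exclude names not yet in use from the cover; the samples at such
          -- names are unchanged by the split.
          · by_cases hl : ℓ = childLeft ⟨t, ht⟩ ∨ ℓ = childRight ⟨t, ht⟩
            · exact hchild ℓ hl hout
            · have hempty : leafSample S (step p S PS ω ⟨t, ht⟩ s).tree ℓ
                  = leafSample S s.tree ℓ := by
                rw [← total_leafData, ← total_leafData, step_of_some p S ω ⟨t, ht⟩ h,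
                  leafData_split_of_ne S _ _ h1 (fun h => hl (Or.inl h)) (fun h => hl (Or.inr h))]
              rw [hempty]
              exact hcov.light ℓ h2 fun hin => hout (active_step_of_ne h hin h1)
      · refine (active_step_subset h).trans ?_
        exact Finset.insert_subset_insert _ (Finset.insert_subset_insert _
          (Finset.erase_subset_erase _ hact))
      · have h2 := Finset.card_erase_add_one he
        have h3 := Finset.card_insert_le (childLeft ⟨t, ht⟩) (insert (childRight ⟨t, ht⟩)
          (𝓛.erase e.leaf))
        have h4 := Finset.card_insert_le (childRight ⟨t, ht⟩) (𝓛.erase e.leaf)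
        omega

/-! ### The labels -/

lemma labelCount_eq (D : Dataset X k) (α : ℝ) (y : Bool) (Z : Fin k → ℝ) :
    labelCount f D α y Z = labelled f D.total y + 4 / α * ∑ i, Z i := by
  have : labelled f D.total y = ∑ i, (D i).countP (fun x => f x = y) := by
    simp only [labelled, Dataset.total]
    exact map_sum (Multiset.countPAddMonoidHom fun x => f x = y) D Finset.univ
  rw [labelCount, Finset.sum_add_distrib, this, Finset.mul_sum]
  push_cast
  rfl

lemma abs_sum_le_of_le {c : ℝ} {Z : Fin k → ℝ} (hZ : ∀ i, |Z i| ≤ c) : |∑ i, Z i| ≤ k * c := by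
  refine (Finset.abs_sum_le_sum_abs _ _).trans ((Finset.sum_le_sum fun i _ => hZ i).trans ?_)
  simp

/-- If noise makes the minority label win, the true counts differ by at most the two noise sums,
each at most (4/α)kc. -/
lemma leafLabel_error_le {c : ℝ} (T : DTree H (Node p)) (ℓ : Node p)
    (hω : ω ℓ ∈ quietSeeds k Ω c) (hα : 0 < p.α) :
    ((leafSample S T ℓ).countP (fun x => leafLabel f p S ω T ℓ ≠ f x) : ℝ)
      ≤ minority f (leafSample S T ℓ) + 8 * k * c / p.α := by
  have h0 := abs_le.1 (abs_sum_le_of_le (hω.2 false))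
  have h1 := abs_le.1 (abs_sum_le_of_le (hω.2 true))
  have ha : 0 < 4 / p.α := by positivity
  have hkc : 8 * k * c / p.α = 4 / p.α * (2 * (k * c)) := by ring
  have hkc0 : 0 ≤ k * c := (abs_nonneg _).trans (abs_sum_le_of_le (hω.2 false))
  have hb0 : 0 ≤ 4 / p.α * (2 * (k * c)) := by positivity
  have hle : ∀ u v, -(k * c) ≤ u → v ≤ k * c → 4 / p.α * (v - u) ≤ 4 / p.α * (2 * (k * c)) :=
    fun u v hu hv => mul_le_mul_of_nonneg_left (by linarith) ha.le
  have hlab : ∀ b, ((leafSample S T ℓ).countP (fun x => b ≠ f x))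
      = labelled f (leafSample S T ℓ) (!b) := by
    intro b
    refine Multiset.countP_congr rfl fun x _ => ?_
    cases b <;> cases f x <;> simp
  rw [hlab, hkc, minority]
  cases hb : leafLabel f p S ω T ℓ
  · simp only [leafLabel, decide_eq_false_iff_not, not_le, labelCount_eq, total_leafData] at hb
    have := hle _ _ h1.1 h0.2
    rw [mul_sub] at this
    rw [Bool.not_false, ← sub_le_iff_le_add]
    refine le_min ?_ ?_ <;> linarith
  · simp only [leafLabel, decide_eq_true_eq, labelCount_eq, total_leafData] at hb
    have := hle _ _ h0.1 h1.2
    rw [mul_sub] at this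
    rw [Bool.not_true, ← sub_le_iff_le_add]
    refine le_min ?_ ?_ <;> linarith

lemma errors_le {c θ : ℝ} (hquiet : ∀ ℓ, ω ℓ ∈ quietSeeds k Ω c) (hα : 0 < p.α)
    {𝓛 : Finset (Node p)} (hcov : LeafCover S (stateAfter p S PS ω p.M le_rfl) θ 𝓛) :
    (S.total.countP (fun x => (dpTopDown f p S PS ω).eval x ≠ f x) : ℝ)
      ≤ ∑ ℓ ∈ 𝓛, minority f (leafSample S (stateAfter p S PS ω p.M le_rfl).tree ℓ)
        + 𝓛.card * (8 * k * c / p.α) := by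
  set T := (stateAfter p S PS ω p.M le_rfl).tree with hT
  rw [← sum_countP_fiber S.total T.eval]
  have h1 : ∀ ℓ, (S.total.filter fun x => T.eval x = ℓ).countP
      (fun x => (dpTopDown f p S PS ω).eval x ≠ f x)
      = (leafSample S T ℓ).countP (fun x => leafLabel f p S ω T ℓ ≠ f x) := by
    intro ℓ
    refine Multiset.countP_congr rfl fun x hx => ?_
    rw [Multiset.mem_filter] at hx
    simp only [dpTopDown, DTree.eval_map]
    rw [← hT, hx.2]
  have h2 : ∑ ℓ, (leafSample S T ℓ).countP (fun x => leafLabel f p S ω T ℓ ≠ f x)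
      = ∑ ℓ ∈ 𝓛, (leafSample S T ℓ).countP (fun x => leafLabel f p S ω T ℓ ≠ f x) := by
    refine (Finset.sum_subset (Finset.subset_univ _) fun ℓ _ hℓ => ?_).symm
    have : leafSample S T ℓ = 0 := by
      rw [leafSample, Multiset.filter_eq_nil]
      rintro x - rfl
      exact hℓ (hcov.eval_mem x)
    simp [this]
  simp only [h1]
  rw [h2]
  push_cast
  refine (Finset.sum_le_sum fun ℓ _ => leafLabel_error_le T ℓ (hquiet ℓ) hα).trans_eq ?_
  rw [Finset.sum_add_distrib, Finset.sum_const, nsmul_eq_mul]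

lemma sum_minority_le_half (T : DTree H (Node p)) (𝓛 : Finset (Node p)) :
    ∑ ℓ ∈ 𝓛, minority f (leafSample S T ℓ) ≤ S.size / 2 := by
  calc ∑ ℓ ∈ 𝓛, minority f (leafSample S T ℓ)
      ≤ ∑ ℓ, ((leafSample S T ℓ).card : ℝ) / 2 :=
        (Finset.sum_le_sum fun ℓ _ => minority_le_half f _).trans
          (Finset.sum_le_sum_of_subset_of_nonneg (Finset.subset_univ _) fun _ _ _ => by positivity)
    _ = S.size / 2 := by rw [← Finset.sum_div, sum_card_leafSample]

/-- Active leaves are charged to their entropy and light leaves to half of their size. -/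
lemma sum_minority_le {s : State H p} {θ : ℝ} {𝓛 : Finset (Node p)} (hθ : 0 ≤ θ)
    (hcov : LeafCover S s θ 𝓛) :
    ∑ ℓ ∈ 𝓛, minority f (leafSample S s.tree ℓ) ≤ s.potential f S + 𝓛.card * (θ / 2) := by
  have h : ∀ ℓ ∈ 𝓛, minority f (leafSample S s.tree ℓ)
      ≤ (if ℓ ∈ s.active then sampleEntropy f (leafSample S s.tree ℓ) else 0) + θ / 2 := by
    intro ℓ hℓ
    split_ifs with h
    · linarith [minority_le_sampleEntropy f (leafSample S s.tree ℓ)]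
    · linarith [minority_le_half f (leafSample S s.tree ℓ), hcov.light ℓ hℓ h]
  refine (Finset.sum_le_sum h).trans ?_
  rw [Finset.sum_add_distrib, Finset.sum_const, nsmul_eq_mul, ← Finset.sum_filter]
  gcongr
  refine Finset.sum_le_sum_of_subset_of_nonneg (fun ℓ hℓ => (Finset.mem_filter.1 hℓ).2)
    fun _ _ _ => sampleEntropy_nonneg f _

end Progress

/-! ### The training error of a good run -/

lemma log_two_le_log_two_div {ε : ℝ} (hε : 0 < ε) (hε1 : ε ≤ 1) :
    Real.log 2 ≤ Real.log (2 / ε) := by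
  refine Real.log_le_log two_pos ?_
  rw [le_div_iff₀ hε]; linarith

/-- With `(1/ε)^(128 log(1/ε) / γ²)` splits the guaranteed decrease of the potential suffices. -/
lemma exp_neg_mul_log_le {γ ε M : ℝ} (hγ : 0 < γ) (hγ1 : γ ≤ 1 / 2) (hε : 0 < ε)
    (hε1 : ε ≤ 3 / 4) (hM : (1 / ε) ^ (128 * Real.log (1 / ε) / γ ^ 2) ≤ M) :
    10 ≤ M ∧ Real.exp (-(γ ^ 2 / (4 * Real.log (2 / ε)) * Real.log (M + 1))) ≤ ε / 4 := by
  set x := Real.log (1 / ε) with hx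
  -- From log(1/ε) ≥ 1 - ε; this is where ε must stay away from 1.
  have hx1 : 1 / 4 ≤ x := by
    have := Real.one_sub_inv_le_log_of_pos (show 0 < 1 / ε by positivity)
    rw [one_div, inv_inv] at this
    have e : x = Real.log ε⁻¹ := by rw [hx, one_div]
    linarith
  have hl := Real.log_two_lt_d9
  have hl' := Real.log_two_gt_d9
  have hL : Real.log (2 / ε) = x + Real.log 2 := by
    rw [hx, show 2 / ε = 1 / ε * 2 by ring, Real.log_mul (by positivity) two_ne_zero]
  have h4 : Real.log (ε / 4) = -(x + 2 * Real.log 2) := by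
    rw [hx, one_div, Real.log_inv, Real.log_div hε.ne' (by norm_num),
      show (4 : ℝ) = 2 ^ 2 by norm_num, Real.log_pow]
    push_cast; ring
  rw [Real.rpow_def_of_pos (by positivity), ← hx] at hM
  set y := x * (128 * x / γ ^ 2) with hy
  have hyx : y = 128 * x ^ 2 / γ ^ 2 := by rw [hy]; ring
  have hg : γ ^ 2 ≤ 1 / 4 := by nlinarith
  have hy10 : 10 ≤ y := by
    rw [hyx, le_div_iff₀ (by positivity)]; nlinarith
  have hM10 : 10 ≤ M := by linarith [Real.add_one_le_exp y]
  refine ⟨hM10, ?_⟩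
  have hlogM : y ≤ Real.log (M + 1) := by
    rw [Real.le_log_iff_exp_le (by linarith)]; linarith
  rw [← Real.le_log_iff_exp_le (by positivity), h4, neg_le_neg_iff, hL]
  have hL0 : 0 < x + Real.log 2 := by linarith
  -- The factor 32 is 128/4, with 128 from the exponent of M and 4 from ρ; it is large enough for
  -- all x ≥ 1/4.
  calc x + 2 * Real.log 2 ≤ 32 * x ^ 2 / (x + Real.log 2) := by
        rw [le_div_iff₀ hL0]; nlinarith
    _ = γ ^ 2 / (4 * (x + Real.log 2)) * y := by rw [hyx]; field_simp; norm_num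
    _ ≤ _ := mul_le_mul_of_nonneg_left hlogM (by positivity)

section Final

variable {X : Type*} {f : X → Bool} {H : Set (X → Bool)} {k : ℕ} {Ω : Type*} {p : Params}
  {S : Dataset X k} {PS : SplitMechanism H k Ω} {ω : Node p → Seed k Ω}

lemma abs_nodeWeight_sub_le {b c : ℝ} (hα : 0 < p.α) (hb : 0 < b)
    (hB : ∀ d ∈ Set.Icc 1 p.M, b ≤ p.B d) (D : Dataset X k) (ℓ : Node p) (d : ℕ) (z : Seed k Ω)
    (hz : z ∈ quietSeeds k Ω c) (hℓ : ℓ ≠ 0) (hd : 1 ≤ d) (hdM : d ≤ p.M) :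
    |nodeWeight p S D ℓ d z - D.size / S.size| ≤ 4 * (k * c) / (p.α * b) / S.size := by
  have hBd := hB d ⟨hd, hdM⟩
  have e : nodeWeight p S D ℓ d z - D.size / S.size
      = (2 / (p.α / 2 * p.B d) * ∑ i, z.2.1 i) / S.size := by
    rw [nodeWeight, if_neg hℓ, weightEstimate, Finset.sum_add_distrib, ← Finset.mul_sum,
      Dataset.size_eq_sum D]
    push_cast
    ring
  have hBpos : 0 < p.B d := hb.trans_le hBd
  rw [e, abs_div, abs_mul, Nat.abs_cast, abs_of_pos (by positivity)]
  refine div_le_div_of_nonneg_right ?_ (Nat.cast_nonneg _)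
  have h1 : 2 / (p.α / 2 * p.B d) ≤ 4 / (p.α * b) := by
    rw [div_le_div_iff₀ (by positivity) (by positivity)]
    nlinarith [mul_le_mul_of_nonneg_left hBd hα.le]
  calc 2 / (p.α / 2 * p.B d) * |∑ i, z.2.1 i| ≤ 4 / (p.α * b) * (k * c) := by
        gcongr
        exact abs_sum_le_of_le hz.1
    _ = 4 * (k * c) / (p.α * b) := by ring

lemma GoodRun.trainError_le [MeasurableSpace X] {γ b c N₀ : ℝ} (hW : WeakLearning f H γ)
    (hγ : 0 < γ) (hε : 0 < p.ε) (hε1 : p.ε ≤ 1) (hα : 0 < p.α) (hb : 0 < b) (hb1 : b ≤ 1)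
    (hB : ∀ d ∈ Set.Icc 1 p.M, b ≤ p.B d) (hc : 0 ≤ c) (hM1 : 1 ≤ p.M)
    (hM : (1 / p.ε) ^ (128 * Real.log (1 / p.ε) / γ ^ 2) ≤ p.M) (hS : 0 < (S.size : ℝ))
    (hnoise : 448 * (p.M * Real.log (2 / p.ε)) * (k * c) ≤ γ ^ 2 * p.ε * (p.α * b) * S.size)
    (hN : 2 * p.M / p.ε * N₀ ≤ S.size)
    (hω : GoodRun f p S PS (γ ^ 2 * p.ε / (112 * (p.M * Real.log (2 / p.ε)))) N₀ c ω) :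
    trainError f S (dpTopDown f p S PS ω) ≤ p.ε := by
  have hγ1 : γ ≤ 1 / 2 := by
    have : 0 < S.total.card := by exact_mod_cast hS
    obtain ⟨x, -⟩ := Multiset.card_pos_iff_exists_mem.1 this
    exact hW.le_half x
  have hg : γ ^ 2 ≤ 1 / 4 := by nlinarith
  set L := Real.log (2 / p.ε) with hLdef
  have hL : 1 / 2 ≤ L := by
    have := log_two_le_log_two_div hε hε1
    linarith [Real.log_two_gt_d9]
  have hM1' : (1 : ℝ) ≤ p.M := by exact_mod_cast hM1
  have hM0 : (0 : ℝ) < p.M := by linarith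
  set η := γ ^ 2 * p.ε / (112 * (p.M * L)) with hη
  have hη0 : 0 ≤ η := by positivity
  -- Uses γ² ≤ 1/4 and L ≥ 1/2. In particular ε/M - η ≥ ε/(2M), the fraction of |S| that the second
  -- sample-size condition makes large enough for a call.
  have hηε : η ≤ p.ε / p.M / 200 := by
    rw [hη, div_div, div_le_div_iff₀ (by positivity) (by positivity)]
    nlinarith [mul_pos hε hM0]
  have hεM : p.ε / p.M ≤ 1 := div_le_one_of_le₀ (by linarith) hM0.le
  have hεM0 : 0 < p.ε / p.M := by positivity
  have hest : ∀ (D : Dataset X k) (ℓ : Node p) (d : ℕ), ∀ z ∈ quietSeeds k Ω c,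
      ℓ ≠ 0 → 1 ≤ d → d ≤ p.M → |nodeWeight p S D ℓ d z - D.size / S.size| ≤ η := by
    intro D ℓ d z hz hℓ hd hdM
    refine (abs_nodeWeight_sub_le hα hb hB D ℓ d z hz hℓ hd hdM).trans ?_
    rw [hη, div_div, div_le_div_iff₀ (by positivity) (by positivity)]
    nlinarith
  have hN1 : N₀ ≤ p.ε / p.M / 2 * S.size := by
    have := mul_le_mul_of_nonneg_left hN (show 0 ≤ p.ε / p.M / 2 by positivity)
    have e : p.ε / p.M / 2 * (2 * p.M / p.ε * N₀) = N₀ := by field_simp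
    rwa [e] at this
  have hgood := fun t ht => hω.goodNode hS hη0 hest
    (hN1.trans (mul_le_of_le_one_left hS.le (by linarith)))
    (hN1.trans (mul_le_mul_of_nonneg_right (by linarith) hS.le)) t ht
  obtain ⟨𝓛, hcov, -, hcard⟩ := exists_leafCover (PS := PS) hω.quiet hS hest p.M le_rfl
  have herr := errors_le (f := f) hω.quiet hα hcov
  have hcard' : (𝓛.card : ℝ) ≤ p.M + 1 := by exact_mod_cast hcard
  -- The labelling noise is controlled by the same sample-size condition as the weight noise, since
  -- b ≤ 1.
  have hlabel : 𝓛.card * (8 * k * c / p.α) ≤ p.ε / 20 * S.size := by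
    have h1 : p.M * (k * c) / p.α ≤ p.ε * S.size / 896 := by
      rw [div_le_div_iff₀ hα (by norm_num)]
      have h2 : 448 * (p.M * (1 / 2)) * (k * c) ≤ 448 * (p.M * L) * (k * c) := by gcongr
      have h3 : γ ^ 2 * p.ε * (p.α * b) * S.size ≤ 1 / 4 * p.ε * (p.α * 1) * S.size := by gcongr
      have : 0 ≤ p.ε * p.α * S.size := by positivity
      nlinarith
    calc 𝓛.card * (8 * k * c / p.α) ≤ (2 * p.M) * (8 * k * c / p.α) := by
          gcongr; linarith
      _ = 16 * (p.M * (k * c) / p.α) := by ring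
      _ ≤ 16 * (p.ε * S.size / 896) := by gcongr
      _ ≤ p.ε / 20 * S.size := by
          have : 0 ≤ p.ε * S.size := by positivity
          nlinarith
  rw [trainError, div_le_iff₀ hS]
  refine herr.trans ?_
  -- Near ε = 1 the hypothesis on M allows M = 1 and gives no decay, but majority labels already err
  -- on at most half of the data.
  by_cases hcase : p.ε ≤ 3 / 4
  -- M ≥ 10 turns the M+1 leaves into at most 11M/10, keeping the light leaves below 3ε/5.
  · obtain ⟨hM10, hexp⟩ := exp_neg_mul_log_le hγ hγ1 hε hcase hM
    have hpot := potential_stateAfter_le hW hγ hε hε1 hS le_rfl (by linarith) hη hgood p.M le_rfl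
    rw [max_eq_left hexp] at hpot
    have hmin := sum_minority_le (f := f) (by positivity) hcov
    have hlight : 𝓛.card * ((p.ε / p.M + η) * S.size / 2) ≤ 3 / 5 * p.ε * S.size := by
      calc 𝓛.card * ((p.ε / p.M + η) * S.size / 2)
          ≤ (11 / 10 * p.M) * ((p.ε / p.M + p.ε / p.M / 200) * S.size / 2) := by
            gcongr; linarith
        _ = 2211 / 4000 * p.ε * S.size := by field_simp; norm_num
        _ ≤ 3 / 5 * p.ε * S.size := by
            have : 0 ≤ p.ε * S.size := by positivity
            linarith
    have : 0 ≤ p.ε * S.size := by positivity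
    linarith
  · push Not at hcase
    have hmin := sum_minority_le_half (f := f) (S := S)
      (stateAfter p S PS ω p.M le_rfl).tree 𝓛
    nlinarith

/-! ### The probability of a good run -/

variable [MeasurableSpace Ω] (P : Measure Ω) [IsProbabilityMeasure P]

lemma seedMeasure_not_goodCall_le {N : ℝ → ℝ → ℝ → ℝ} (hPS : IsPrivateSplit f H P PS N)
    (hN : ∀ ζ δ : ℝ, 0 < ζ → 0 < δ → δ ≤ 1 → AntitoneOn (fun a => N ζ a δ) (Set.Ioi 0))
    {ζ b : ℝ} (hζ : 0 < ζ) (hα : 0 < p.α) (hb : 0 < b) (hM1 : 1 ≤ p.M)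
    (hB : ∀ d ∈ Set.Icc 1 p.M, b ≤ p.B d) (hδ : 0 < callDelta p) (hδ1 : callDelta p ≤ 1)
    (D : Dataset X k) (ℓ : Node p) (d : ℕ) (hd : ℓ = 0 ∨ (1 ≤ d ∧ d ≤ p.M))
    (hD : N ζ (p.α * b / 4) (callDelta p) ≤ D.size) :
    seedMeasure k P {z | ¬ GoodCall f p PS ζ D ℓ d z} ≤ ENNReal.ofReal (callDelta p) := by
  -- The smallest budget of any call is αb/4, and the data requirement only falls as the budget
  -- grows.
  have hbud : p.α * b / 4 ≤ callBudget p ℓ d := by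
    rw [callBudget]
    split_ifs with h
    · nlinarith [hB 1 ⟨le_rfl, hM1⟩, mul_le_mul_of_nonneg_left (hB 1 ⟨le_rfl, hM1⟩) hα.le,
        mul_pos hα hb]
    · nlinarith [mul_le_mul_of_nonneg_left (hB d (hd.resolve_left h)) hα.le]
  have hpos : 0 < p.α * b / 4 := by positivity
  have hut := hPS.utility ζ (callBudget p ℓ d) (callDelta p) hζ (hpos.trans_le hbud) hδ hδ1 D
    ((hN ζ _ hζ hδ hδ1 hpos (hpos.trans_le hbud) hbud).trans hD)
  have hmeas := measurableSet_goodCall f hPS.measurable ζ D ℓ d (p := p)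
  let A : Set Ω := {w | GoodCall f p PS ζ D ℓ d (w, fun _ => 0, fun _ _ => 0)}
  have hA : MeasurableSet A := (measurable_id.prodMk measurable_const) hmeas
  have h1 : seedMeasure k P {z | GoodCall f p PS ζ D ℓ d z} = P A :=
    (measurePreserving_fst (μ := P)).measure_preimage hA.nullMeasurableSet
  have h2 : {z : Seed k Ω | ¬ GoodCall f p PS ζ D ℓ d z} = {z | GoodCall f p PS ζ D ℓ d z}ᶜ := rfl
  rw [h2, prob_compl_eq_one_sub hmeas, h1, tsub_le_iff_right]
  calc (1 : ENNReal) = ENNReal.ofReal (callDelta p) + ENNReal.ofReal (1 - callDelta p) := by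
        rw [← ENNReal.ofReal_add hδ.le (by linarith)]; simp
    _ ≤ _ := add_le_add_right hut _

/-- With x = 2kM/δ ≥ 2 the argument on the left is at most 9x ≤ x⁵, so the noise threshold has the
logarithm of the sample-size condition up to a factor 5. -/
lemma log_failure_le {k M δ : ℝ} (hk : 1 ≤ k) (hM : 1 ≤ M) (hδ : 0 < δ) (hδ1 : δ ≤ 1) :
    0 ≤ Real.log (6 * k * (2 * M + 1) / δ) ∧
      Real.log (6 * k * (2 * M + 1) / δ) ≤ 5 * Real.log (2 * (k * M) / δ) := by
  have hkM : 1 ≤ k * M := one_le_mul_of_one_le_of_one_le hk hM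
  have hx : 2 ≤ 2 * (k * M) / δ := by rw [le_div_iff₀ hδ]; nlinarith
  constructor
  · refine Real.log_nonneg ?_
    rw [le_div_iff₀ hδ]; nlinarith
  · have h5 : 5 * Real.log (2 * (k * M) / δ) = Real.log ((2 * (k * M) / δ) ^ 5) := by
      rw [Real.log_pow]; norm_num
    rw [h5]
    refine Real.log_le_log (by positivity) ?_
    have h9 : 6 * k * (2 * M + 1) / δ ≤ 9 * (2 * (k * M) / δ) := by
      rw [mul_div_assoc', div_le_div_iff_of_pos_right hδ]; nlinarith
    have h16 : (2 : ℝ) ^ 4 ≤ (2 * (k * M) / δ) ^ 4 := pow_le_pow_left₀ two_pos.le hx 4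
    calc 6 * k * (2 * M + 1) / δ ≤ 9 * (2 * (k * M) / δ) := h9
      _ ≤ (2 * (k * M) / δ) ^ 4 * (2 * (k * M) / δ) := by gcongr; linarith
      _ = (2 * (k * M) / δ) ^ 5 := by ring

lemma one_sub_le_runMeasure_goodRun {N : ℝ → ℝ → ℝ → ℝ} (hPS : IsPrivateSplit f H P PS N)
    (hN : ∀ ζ δ : ℝ, 0 < ζ → 0 < δ → δ ≤ 1 → AntitoneOn (fun a => N ζ a δ) (Set.Ioi 0))
    {ζ b : ℝ} (hζ : 0 < ζ) (hα : 0 < p.α) (hb : 0 < b) (hk : 1 ≤ k) (hM1 : 1 ≤ p.M)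
    (hB : ∀ d ∈ Set.Icc 1 p.M, b ≤ p.B d) (hδ : 0 < p.δ) (hδ1 : p.δ ≤ 1) :
    ENNReal.ofReal (1 - p.δ) ≤ runMeasure p k P {ω | GoodRun f p S PS ζ
      (N ζ (p.α * b / 4) (callDelta p)) (Real.log (6 * k * (2 * p.M + 1) / p.δ)) ω} := by
  have hk' : (1 : ℝ) ≤ k := by exact_mod_cast hk
  have hM' : (1 : ℝ) ≤ p.M := by exact_mod_cast hM1
  have hcd : 0 < callDelta p := by rw [callDelta]; positivity
  have hcd1 : callDelta p ≤ 1 := by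
    rw [callDelta, div_le_one (by positivity)]; linarith
  have hbad := runMeasure_not_goodRun_le f (S := S) P hPS.measurable
    (log_failure_le hk' hM' hδ hδ1).1
    (fun D ℓ d hd hD => seedMeasure_not_goodCall_le P hPS hN hζ hα hb hM1 hB hcd hcd1 D ℓ d hd hD)
  have hbad' : runMeasure p k P {ω | ¬ GoodRun f p S PS ζ (N ζ (p.α * b / 4) (callDelta p))
      (Real.log (6 * k * (2 * p.M + 1) / p.δ)) ω} ≤ ENNReal.ofReal p.δ := by
    -- At this threshold 3k·exp(-c) equals the failure probability of one call, δ/(2(2M+1)); the two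
    -- together, over 2M+1 nodes, give exactly δ.
    refine hbad.trans (le_of_eq ?_)
    have e1 : (2 * p.M + 1 : ENNReal) = ENNReal.ofReal (2 * p.M + 1) := by
      rw [ENNReal.ofReal_add (by positivity) zero_le_one, ENNReal.ofReal_mul two_pos.le]
      simp
    rw [e1, ← ENNReal.ofReal_add (by positivity) hcd.le, ← ENNReal.ofReal_mul (by positivity),
      Real.exp_neg, Real.exp_log (by positivity), callDelta]
    congr 1
    field_simp
    norm_num
  have huniv : runMeasure p k P Set.univ = 1 :=
    measure_univ (μ := Measure.pi fun _ : Node p => seedMeasure k P)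
  -- Subadditivity suffices, so the good event need not be measurable.
  have hone := measure_univ_le_add_compl (μ := runMeasure p k P) {ω | GoodRun f p S PS ζ
    (N ζ (p.α * b / 4) (callDelta p)) (Real.log (6 * k * (2 * p.M + 1) / p.δ)) ω}
  rw [huniv] at hone
  rw [ENNReal.ofReal_sub _ hδ.le, ENNReal.ofReal_one, tsub_le_iff_right]
  exact hone.trans (add_le_add_right hbad' _)

end Final

end DPTopDown

/-! ### The theorem with explicit constants -/

theorem mainTheorem4 :
    ∃ C₁ C₂ c₃ : ℝ, 0 < C₁ ∧ 0 < C₂ ∧ 0 < c₃ ∧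
      ∀ {X : Type*} [MeasurableSpace X] (f : X → Bool) (H : Set (X → Bool)) (γ : ℝ),
      0 < γ → DPTopDown.WeakLearning f H γ →
      ∀ (k : ℕ), 1 ≤ k →
      ∀ {Ω : Type*} [MeasurableSpace Ω] (P : MeasureTheory.Measure Ω)
        [MeasureTheory.IsProbabilityMeasure P]
        (PS : DPTopDown.SplitMechanism H k Ω) (N : ℝ → ℝ → ℝ → ℝ),
      DPTopDown.IsPrivateSplit f H P PS N →
      (∀ ζ δ : ℝ, 0 < ζ → 0 < δ → δ ≤ 1 → AntitoneOn (fun a => N ζ a δ) (Set.Ioi 0)) →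
      ∀ (M : ℕ) (ε α δ b : ℝ) (B : ℕ → ℝ),
      0 < ε → ε ≤ 1 → 0 < α → 0 < δ → δ ≤ 1 →
      (∀ d ∈ Finset.Icc 1 M, 0 < B d) → ∑ d ∈ Finset.Icc 1 M, B d ≤ 1 →
      IsLeast (B '' Set.Icc 1 M) b →
      (1 / ε) ^ (C₁ * Real.log (1 / ε) / γ ^ 2) ≤ (M : ℝ) →
      ∀ S : DPTopDown.Dataset X k,
      max (C₂ * ((k * M : ℝ) / (γ ^ 2 * ε * α * b))
              * (Real.log (2 * (k * M : ℝ) / δ) * Real.log (2 / ε)))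
          (2 * (M : ℝ) / ε *
            N (c₃ * (γ ^ 2 * ε) / ((M : ℝ) * Real.log (2 / ε))) (α * b / 4)
              (δ / (2 * (2 * (M : ℝ) + 1))))
        ≤ (S.size : ℝ) →
      ENNReal.ofReal (1 - δ) ≤
        DPTopDown.runMeasure ⟨M, ε, α, δ, B⟩ k P
          {ω | DPTopDown.trainError f S (DPTopDown.dpTopDown f ⟨M, ε, α, δ, B⟩ S PS ω) ≤ ε} := by
  -- 128 makes the power law reach ε/4 and 1/112 is the constant of η. In 2240 = 4 · 112 · 5, the 4
  -- comes from the Laplace scale 4/(αb) and the 5 from `log_failure_le`.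
  refine ⟨128, 2240, 1 / 112, by norm_num, by norm_num, by norm_num, ?_⟩
  intro X _ f H γ hγ hW k hk Ω _ P _ PS N hPS hN M ε α δ b B hε hε1 hα hδ hδ1 hBpos hBsum hb hM S
    hsize
  obtain ⟨⟨d₀, hd₀, rfl⟩, hlow⟩ := hb
  have hM1 : 1 ≤ M := hd₀.1.trans hd₀.2
  have hmem : ∀ d, d ∈ Set.Icc 1 M → d ∈ Finset.Icc 1 M := fun d hd => Finset.mem_Icc.2 hd
  have hb0 : 0 < B d₀ := hBpos d₀ (hmem d₀ hd₀)
  have hb1 : B d₀ ≤ 1 :=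
    (Finset.single_le_sum (fun d hd => (hBpos d hd).le) (hmem d₀ hd₀)).trans hBsum
  have hB : ∀ d ∈ Set.Icc 1 M, B d₀ ≤ B d := fun d hd => hlow ⟨d, hd, rfl⟩
  have hM1' : (1 : ℝ) ≤ M := by exact_mod_cast hM1
  have hk' : (1 : ℝ) ≤ k := by exact_mod_cast hk
  have hL : 0 < Real.log (2 / ε) :=
    (Real.log_pos one_lt_two).trans_le (DPTopDown.log_two_le_log_two_div hε hε1)
  have hζ : (1 / 112 * (γ ^ 2 * ε) / ((M : ℝ) * Real.log (2 / ε)))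
      = γ ^ 2 * ε / (112 * (M * Real.log (2 / ε))) := by field_simp
  rw [max_le_iff, hζ] at hsize
  obtain ⟨hs1, hs2⟩ := hsize
  obtain ⟨hc0, hc5⟩ := DPTopDown.log_failure_le hk' hM1' hδ hδ1
  refine (DPTopDown.one_sub_le_runMeasure_goodRun (p := ⟨M, ε, α, δ, B⟩) (S := S) P hPS hN
    (ζ := γ ^ 2 * ε / (112 * (M * Real.log (2 / ε)))) (by positivity) hα hb0 hk hM1 hB hδ
    hδ1).trans (measure_mono fun ω hω => ?_)
  change DPTopDown.trainError f S (DPTopDown.dpTopDown f ⟨M, ε, α, δ, B⟩ S PS ω) ≤ ε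
  -- On empty data the training error is 0/0 = 0; a data point is needed later to obtain γ ≤ 1/2.
  rcases (Nat.cast_nonneg S.size : (0 : ℝ) ≤ S.size).eq_or_lt with hS | hS
  · rw [DPTopDown.trainError, ← hS, div_zero]; exact hε.le
  refine DPTopDown.GoodRun.trainError_le (p := ⟨M, ε, α, δ, B⟩) hW hγ hε hε1 hα hb0 hb1 hB hc0 hM1
    hM hS ?_ hs2 hω
  have h1 : 448 * (M * Real.log (2 / ε)) * (k * Real.log (6 * k * (2 * M + 1) / δ))
      ≤ 448 * (M * Real.log (2 / ε)) * (k * (5 * Real.log (2 * (k * M) / δ))) := by gcongr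
  have h2 := mul_le_mul_of_nonneg_left hs1 (show 0 ≤ γ ^ 2 * ε * (α * B d₀) by positivity)
  have e : γ ^ 2 * ε * (α * B d₀) * (2240 * ((k * M : ℝ) / (γ ^ 2 * ε * α * B d₀))
      * (Real.log (2 * (k * M : ℝ) / δ) * Real.log (2 / ε)))
      = 448 * (M * Real.log (2 / ε)) * (k * (5 * Real.log (2 * (k * M) / δ))) := by
    field_simp; ring
  rw [e] at h2
  exact h1.trans h2
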